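/- Let $W=(Q,X,Y)$ have law $P$, where $Q$ has support $\{0,1,2\}$, $X$ takes values in a measurable space $\mathcal X$ and $Y$ is real; $Q=2$ marks the experimental data and $Q\in\{0,1\}$ the treatment in the observational data. Write $\rho_q=\Pr(Q=q)$, $m_q(x)=\mathbb E[Y\mid X=x,Q=q]$, $\Delta=m_1-m_0$, $r(x)=\Pr(Q=1\mid X=x,Q\ne2)$, and $\Lambda=dP_{X\mid Q=2}/dP_{X\mid Q\neq 2}$. Let $\psi:\mathbb R\to\mathbb R^k$ be continuously differentiable with derivative $\dot\psi$. Assume that $P_{X\mid Q=2}$ is absolutely continuous with respect to $P_{X\mid Q\ne2}$; that $0<r(X)<1$ almost surely given $Q\neq2$; that $Y$ is integrable, and that $\psi(\Delta(X))$ given $Q\ne2$, and $\psi(\Delta(X))\psi(\Delta(X))^\top$ and $Y\psi(\Delta(X))$ given $Q=2$, are integrable; and that $\Pr(c^\top\psi(\Delta(X))=0\mid Q=2)<1$ for every $c\in\mathbb R^k\setminus\{0\}$. Put $$G=\mathbb E[\psi(\Delta(X))\psi(\Delta(X))^\top\mid Q=2],\quad \bar\beta=G^{-1}\,\mathbb E[Y\psi(\Delta(X))\mid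 Q=2],\quad \bar\alpha=G^{-1}\,\mathbb E[\psi(\Delta(X))\mid Q\ne2],$$ $\bar\mu(x)=\psi(\Delta(x))^\top\bar\beta$, and consider the estimand $\bar\tau=\mathbb E[\psi(\Delta(X))\mid Q\neq2]^\top\bar\beta$. For $w=(q,x,y)$ let $$\iota(w)=\frac{\mathbf 1(q=1)}{r(x)}(y-m_1(x))-\frac{\mathbf 1(q=0)}{1-r(x)}(y-m_0(x)),$$ $$\kappa(x)=\dot\psi(\Delta(x))^\top\bar\beta+\Lambda(x)\,\bar\alpha^\top\Big(m_2(x)\dot\psi(\Delta(x))-\big[\psi(\Delta(x))\dot\psi(\Delta(x))^\top+\dot\psi(\Delta(x))\psi(\Delta(x))^\top\big]\bar\beta\Big),$$ $$\varphi(w)=\frac{\mathbf 1(q\ne2)}{1-\rho_2}\big(\bar\mu(x)-\bar\tau+\iota(w)\kappa(x)\big)+\frac{\mathbf 1(q=2)}{\rho_2}(y-\bar\mu(x))\,\bar\alpha^\top\psi(\Delta(x)),\qquad V_{\rm eff}=\mathbb E[\varphi(W)^2]\in[0,\infty].$$ In the nonparametric model, a smooth submodel through $P$ is a family $dP_\theta=p_\theta\,dP$,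 $|\theta|<\varepsilon$, of probability measures with $p_\theta>0$ and $p_0=1$ a.s., such that $\theta\mapsto p_\theta(w)$ is differentiable at $0$ for almost every $w$, the score $s=\partial_\theta p_\theta|_{\theta=0}$ is square integrable, and the difference quotients at $\theta=0$ of the integrands $p_\theta$, $\mathbf 1(q\ne2)\,y\,p_\theta$, $\mathbf 1(q\neq2)\psi_j(\Delta_\theta)p_\theta$, $\mathbf 1(q=2)\psi_i(\Delta_\theta)\psi_j(\Delta_\theta)p_\theta$ and $\mathbf 1(q=2)\,y\,\psi_j(\Delta_\theta)p_\theta$ are dominated by $P$-integrable functions; here $\Delta_\theta$ is the function $\Delta$ of $P_\theta$. (a) Along every smooth submodel, $\theta\mapsto\bar\tau(P_\theta)$ is differentiable at $0$, with derivative $\mathbb E[\varphi(W)s(W)]$ whenever $\varphi(W)s(W)$ is integrable. The tangent space (the closed linear span in $L^2(P)$ of the scores of smooth submodels) is the space of all mean-zero functions in $L^2(P)$. If $V_{\rm eff}<\infty$, then $\varphi$ is the efficient influence function of $\bar\tau$ at $P$, i.e. the almost surely unique element of the tangent space such that the derivative of $\bar\tau$ along every smooth submodel is $\mathbb E[\varphi(W)s(W)]$.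 (b) The semiparametric efficiency bound for $\bar\tau$, i.e. the supremum over smooth submodels of $(\partial_\theta\bar\tau(P_\theta)|_{\theta=0})^2/\mathbb E[s(W)^2]$ (with $0/0=0$), equals $V_{\rm eff}$. (c) If $V_{\rm eff}<\infty$, let $\Sigma=\mathbb E[(Y-\bar\mu(X))^2\,\bar\alpha^\top\psi(\Delta(X))\psi(\Delta(X))^\top\bar\alpha\mid Q=2]$. This expectation is finite, and it equals $\bar\alpha^\top\,\mathbb E[(Y-\bar\mu(X))^2\psi(\Delta(X))\psi(\Delta(X))^\top\mid Q=2]\,\bar\alpha$ whenever the latter matrix has integrable entries. Along every sequence of laws of $W$ that have the same conditional laws of $W$ given $Q=2$ and given $Q\neq2$ as $P$ and for which $\rho_2\to0$, we have $\rho_2V_{\rm eff}\to\Sigma$. -/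

import Mathlib

open MeasureTheory ProbabilityTheory Filter Topology Matrix
open scoped ENNReal

noncomputable section

namespace FusedData

/-- An observation `w = (q, x, y)` of the fused dataset: `q = 2` marks the experimental records,
`q = 0, 1` the observational records with that treatment, `x` is the covariate and `y` the
outcome. -/
abbrev Record (𝒳 : Type*) := Fin 3 × 𝒳 × ℝ

section

variable {𝒳 : Type*} [MeasurableSpace 𝒳] {k : ℕ}

/-- The conditional law of `W` given `Q = 2`. -/
def rctLaw (P : Measure (Record 𝒳)) : Measure (Record 𝒳) :=
  ProbabilityTheory.cond P {w | w.1 = 2}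

/-- The conditional law of `W` given `Q ≠ 2`. -/
def obsLaw (P : Measure (Record 𝒳)) : Measure (Record 𝒳) :=
  ProbabilityTheory.cond P {w | w.1 ≠ 2}

/-- The conditional law of `X` given `Q = 2`. -/
def rctX (P : Measure (Record 𝒳)) : Measure 𝒳 := (rctLaw P).map (fun w => w.2.1)

/-- The conditional law of `X` given `Q ≠ 2`. -/
def obsX (P : Measure (Record 𝒳)) : Measure 𝒳 := (obsLaw P).map (fun w => w.2.1)

/-- `ρ_q = Pr(Q = q)`. -/
def rho (P : Measure (Record 𝒳)) (q : Fin 3) : ℝ := P.real {w | w.1 = q}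

/-- The conditional law of `(X, Y)` given `Q = q`. -/
def lawXY (P : Measure (Record 𝒳)) (q : Fin 3) : Measure (𝒳 × ℝ) :=
  (ProbabilityTheory.cond P {w | w.1 = q}).map (fun w => w.2)

instance (P : Measure (Record 𝒳)) (q : Fin 3) : IsFiniteMeasure (lawXY P q) := by
  unfold lawXY; infer_instance

/-- `m_q(x) = E[Y | X = x, Q = q]`, the mean of the regular conditional distribution. -/
def condMean (P : Measure (Record 𝒳)) (q : Fin 3) (x : 𝒳) : ℝ :=
  ∫ y, y ∂((lawXY P q).condKernel x)

/-- The observational treatment-control contrast `Δ(x) = m₁(x) - m₀(x)`. -/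
def contrast (P : Measure (Record 𝒳)) (x : 𝒳) : ℝ := condMean P 1 x - condMean P 0 x

/-- The observational propensity score `r(x) = Pr(Q = 1 | X = x, Q ≠ 2)`: the density of
`B ↦ Pr(Q = 1, X ∈ B | Q ≠ 2)` with respect to the law of `X` given `Q ≠ 2`. -/
def propensity (P : Measure (Record 𝒳)) (x : 𝒳) : ℝ :=
  ((((obsLaw P).restrict {w | w.1 = 1}).map (fun w => w.2.1)).rnDeriv (obsX P) x).toReal

/-- The likelihood ratio `Λ` of the law of `X` given `Q = 2` to the law of `X` given `Q ≠ 2`. -/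
def likRatio (P : Measure (Record 𝒳)) (x : 𝒳) : ℝ := ((rctX P).rnDeriv (obsX P) x).toReal

/-- `ψ(Δ(x))`, for a basis expansion `ψ : ℝ → ℝᵏ`. -/
def feat (ψ : ℝ → Fin k → ℝ) (P : Measure (Record 𝒳)) (x : 𝒳) : Fin k → ℝ := ψ (contrast P x)

/-- `E[ψ(Δ(X)) ψ(Δ(X))ᵀ | Q = 2]`. -/
def gram (ψ : ℝ → Fin k → ℝ) (P : Measure (Record 𝒳)) : Matrix (Fin k) (Fin k) ℝ :=
  Matrix.of fun i j => ∫ w, feat ψ P w.2.1 i * feat ψ P w.2.1 j ∂(rctLaw P)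

/-- `E[Y ψ(Δ(X)) | Q = 2]`. -/
def crossMoment (ψ : ℝ → Fin k → ℝ) (P : Measure (Record 𝒳)) : Fin k → ℝ :=
  fun j => ∫ w, w.2.2 * feat ψ P w.2.1 j ∂(rctLaw P)

/-- `E[ψ(Δ(X)) | Q ≠ 2]`. -/
def obsMoment (ψ : ℝ → Fin k → ℝ) (P : Measure (Record 𝒳)) : Fin k → ℝ :=
  fun j => ∫ w, feat ψ P w.2.1 j ∂(obsLaw P)

/-- The coefficients `β̄` of the population least squares regression of `Y` on `ψ(Δ(X))` given
`Q = 2`. -/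
def betaBar (ψ : ℝ → Fin k → ℝ) (P : Measure (Record 𝒳)) : Fin k → ℝ :=
  (gram ψ P)⁻¹ *ᵥ crossMoment ψ P

/-- `ᾱ = E[ψ(Δ(X)) ψ(Δ(X))ᵀ | Q = 2]⁻¹ E[ψ(Δ(X)) | Q ≠ 2]`. -/
def alphaBar (ψ : ℝ → Fin k → ℝ) (P : Measure (Record 𝒳)) : Fin k → ℝ :=
  (gram ψ P)⁻¹ *ᵥ obsMoment ψ P

/-- `μ̄(x) = ψ(Δ(x))ᵀ β̄`. -/
def muBar (ψ : ℝ → Fin k → ℝ) (P : Measure (Record 𝒳)) (x : 𝒳) : ℝ :=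
  feat ψ P x ⬝ᵥ betaBar ψ P

/-- The projected estimand `τ̄ = E[ψ(Δ(X)) | Q ≠ 2]ᵀ β̄`. -/
def tauBar (ψ : ℝ → Fin k → ℝ) (P : Measure (Record 𝒳)) : ℝ :=
  obsMoment ψ P ⬝ᵥ betaBar ψ P

/-! ### The explicit formulas -/

def iota (P : Measure (Record 𝒳)) (w : Record 𝒳) : ℝ :=
  (if w.1 = 1 then 1 / propensity P w.2.1 * (w.2.2 - condMean P 1 w.2.1) else 0)
    - (if w.1 = 0 then 1 / (1 - propensity P w.2.1) * (w.2.2 - condMean P 0 w.2.1) else 0)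

def kappa (ψ : ℝ → Fin k → ℝ) (P : Measure (Record 𝒳)) (x : 𝒳) : ℝ :=
  deriv ψ (contrast P x) ⬝ᵥ betaBar ψ P
    + likRatio P x * (alphaBar ψ P ⬝ᵥ
      (condMean P 2 x • deriv ψ (contrast P x)
        - (vecMulVec (feat ψ P x) (deriv ψ (contrast P x))
            + vecMulVec (deriv ψ (contrast P x)) (feat ψ P x)) *ᵥ betaBar ψ P))

/-- The candidate efficient influence function. -/
def eif (ψ : ℝ → Fin k → ℝ) (P : Measure (Record 𝒳)) (w : Record 𝒳) : ℝ :=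
  (if w.1 ≠ 2 then
      1 / (1 - rho P 2) * (muBar ψ P w.2.1 - tauBar ψ P + iota P w * kappa ψ P w.2.1)
    else 0)
  + (if w.1 = 2 then
      1 / rho P 2 * (w.2.2 - muBar ψ P w.2.1) * (alphaBar ψ P ⬝ᵥ feat ψ P w.2.1)
    else 0)

/-- `V_eff`, the (possibly infinite) second moment of `eif`. -/
def Veff (ψ : ℝ → Fin k → ℝ) (P : Measure (Record 𝒳)) : ℝ≥0∞ :=
  ∫⁻ w, ENNReal.ofReal (eif ψ P w ^ 2) ∂P

/-- The integrand of `meat`, entrywise: `(y - μ̄(x))² ψ(Δ(x)) ψ(Δ(x))ᵀ`. -/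
def meatIntegrand (ψ : ℝ → Fin k → ℝ) (P : Measure (Record 𝒳)) (w : Record 𝒳) :
    Matrix (Fin k) (Fin k) ℝ :=
  (w.2.2 - muBar ψ P w.2.1) ^ 2 • vecMulVec (feat ψ P w.2.1) (feat ψ P w.2.1)

/-- `E[(Y - μ̄(X))² ψ(Δ(X)) ψ(Δ(X))ᵀ | Q = 2]`. -/
def meat (ψ : ℝ → Fin k → ℝ) (P : Measure (Record 𝒳)) : Matrix (Fin k) (Fin k) ℝ :=
  Matrix.of fun i j => ∫ w, meatIntegrand ψ P w i j ∂(rctLaw P)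

/-- `Σ = E[(Y - μ̄(X))² ᾱᵀ ψ(Δ(X)) ψ(Δ(X))ᵀ ᾱ | Q = 2]`. The constant `ᾱ` stands inside the
expectation, where the expression needs no more than that this scalar be integrable; it equals
`ᾱᵀ (meat) ᾱ` whenever the entries of `meat` are integrable. -/
def Sig (ψ : ℝ → Fin k → ℝ) (P : Measure (Record 𝒳)) : ℝ :=
  ∫ w, alphaBar ψ P ⬝ᵥ (meatIntegrand ψ P w *ᵥ alphaBar ψ P) ∂(rctLaw P)

/-! ### Smooth parametric submodels of the nonparametric model -/

/-- `P_θ`, the law with density `p θ` with respect to `P`. -/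
def tilt (P : Measure (Record 𝒳)) (p : ℝ → Record 𝒳 → ℝ) (θ : ℝ) : Measure (Record 𝒳) :=
  P.withDensity fun w => ENNReal.ofReal (p θ w)

/-- The difference quotients at `0` of `θ ↦ F θ w`, `|θ| < ε`, are dominated by a `P`-integrable
function of `w`. -/
def DominatedQuotients (P : Measure (Record 𝒳)) (ε : ℝ) (F : ℝ → Record 𝒳 → ℝ) : Prop :=
  ∃ B : Record 𝒳 → ℝ, Integrable B P ∧
    ∀ θ, |θ| < ε → ∀ᵐ w ∂P, |F θ w - F 0 w| ≤ B w * |θ|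

/-- A smooth one-parameter submodel through `P`, with common support: `P_θ` has density `p θ > 0`
with respect to `P`, `p 0 = 1`, the density is differentiable in `θ` at `0` with square integrable
score `s = ∂/∂θ log p = ∂/∂θ p` at `θ = 0`, and the integrals over `w` that define
`τ̄(P_θ)` (total mass, conditional means of `Y` given `X` and `Q ∈ {0, 1}`, and the three moments
of `ψ(Δ_θ(X))`) have integrands with dominated difference quotients, so that they can be
differentiated under the integral sign. -/
structure SmoothSubmodel (ψ : ℝ → Fin k → ℝ) (P : Measure (Record 𝒳)) where
  ε : ℝ
  ε_pos : 0 < ε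
  p : ℝ → Record 𝒳 → ℝ
  score : Record 𝒳 → ℝ
  measurable_p : ∀ θ, Measurable (p θ)
  p_pos : ∀ θ, |θ| < ε → ∀ᵐ w ∂P, 0 < p θ w
  isProb : ∀ θ, |θ| < ε → IsProbabilityMeasure (tilt P p θ)
  p_zero : ∀ᵐ w ∂P, p 0 w = 1
  hasDeriv : ∀ᵐ w ∂P, HasDerivAt (fun θ => p θ w) (score w) 0
  memLp_score : MemLp score 2 P
  dom_mass : DominatedQuotients P ε p
  dom_condMean : DominatedQuotients P ε fun θ w => if w.1 ≠ 2 then w.2.2 * p θ w else 0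
  dom_obsMoment : ∀ j, DominatedQuotients P ε fun θ w =>
    if w.1 ≠ 2 then feat ψ (tilt P p θ) w.2.1 j * p θ w else 0
  dom_gram : ∀ i j, DominatedQuotients P ε fun θ w =>
    if w.1 = 2 then feat ψ (tilt P p θ) w.2.1 i * feat ψ (tilt P p θ) w.2.1 j * p θ w else 0
  dom_crossMoment : ∀ j, DominatedQuotients P ε fun θ w =>
    if w.1 = 2 then w.2.2 * feat ψ (tilt P p θ) w.2.1 j * p θ w else 0

/-- The value `τ̄(θ)` of the estimand along a submodel. -/
def SmoothSubmodel.tau {ψ : ℝ → Fin k → ℝ} {P : Measure (Record 𝒳)} (M : SmoothSubmodel ψ P)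
    (θ : ℝ) : ℝ := tauBar ψ (tilt P M.p θ)

/-- The tangent space at `P`: the closed linear span in `L²(P)` of the scores of all smooth
submodels. -/
def tangentSpace (ψ : ℝ → Fin k → ℝ) (P : Measure (Record 𝒳)) : Submodule ℝ (Lp ℝ 2 P) :=
  (Submodule.span ℝ
    {g : Lp ℝ 2 P | ∃ M : SmoothSubmodel ψ P, (g : Record 𝒳 → ℝ) =ᵐ[P] M.score}).topologicalClosure

/-- `φ` is the efficient influence function of `τ̄` at `P`: a square integrable function in the
tangent space that represents the derivative of `τ̄` along every smooth submodel as an inner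
product with the score. -/
structure IsEfficientInfluenceFunction (ψ : ℝ → Fin k → ℝ) (P : Measure (Record 𝒳))
    (φ : Record 𝒳 → ℝ) : Prop where
  memLp : MemLp φ 2 P
  mem_tangentSpace : memLp.toLp φ ∈ tangentSpace ψ P
  gradient : ∀ M : SmoothSubmodel ψ P, HasDerivAt M.tau (∫ w, φ w * M.score w ∂P) 0

/-- The semiparametric efficiency bound: the supremum of the Cramér–Rao bounds
`(∂τ̄/∂θ)² / E[s²]` over all smooth submodels (with `0 / 0 = 0`). -/
def efficiencyBound (ψ : ℝ → Fin k → ℝ) (P : Measure (Record 𝒳)) : ℝ≥0∞ :=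
  sSup {b | ∃ (M : SmoothSubmodel ψ P) (d : ℝ), HasDerivAt M.tau d 0 ∧
    b = ENNReal.ofReal (d ^ 2) / ENNReal.ofReal (∫ w, M.score w ^ 2 ∂P)}

end

end FusedData

end

noncomputable section

namespace FusedData

variable {𝒳 : Type*} [MeasurableSpace 𝒳] {k : ℕ}

/-! ### Disintegration of the law of the record over the arms and the covariate -/

/-! The derivative. Up to normalisation, `τ̄` is `N⁻¹ Aᵀ G⁻¹ C`, with `N`, `A`, `G`, `C` integrals
of the form `∫ g · f(Δ_θ) · p_θ dP`. Dominated convergence differentiates each of them into a term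
with the score `s` and a term with the derivative of `Δ_θ`, the latter obtained from the quotient
formula for conditional means under a tilted law (`condMean_tilt_mul`). Quotient and product rules
then write the derivative of `τ̄` as `∫ gradientIntegrand dP` (`SmoothSubmodel.hasDerivAt_tau`).

The gradient. The derivative of `Δ_θ(x)` is a difference of conditional covariances of `Y` with the
score in arms 1 and 0. Disintegrating `P` over the arms and the covariate, with all covariate laws
expressed by densities against the observational one, places the three arms over the same `x`. There
the inverse propensities in `ι` undo the arm densities, and `Λ` carries the experimental
contribution to the observational law. Hence `φ s - gradientIntegrand` has vanishing weighted
conditional integral at almost every `x` (`Identified.integral_eif_mul_score`). Only `φ s` itself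
has to be integrable, since `gradientIntegrand` always is.

The tangent space. Scores have mean zero because total mass is constant. Conversely, a bounded mean
zero `s` supported where `E[|Y| | X, Q = q]` is bounded for `q = 0, 1` is the score of the path `1 +
θ s` (`TameScore.submodel`). Centred truncations of any measurable function have this form. If `z`
in `L²` is orthogonal to all scores, pairing it with its own truncation gives the squared norm of
that truncation, which is therefore zero; if moreover `z` has mean zero, the limit gives `z = 0`.

The bound. Cauchy–Schwarz gives `≤` when `V_eff` is finite. The truncations `s_n` of `φ` satisfy `∫
φ s_n = ∫ s_n²`, so their Cramér–Rao ratios are `∫ s_n²`. A uniform bound on these forces `φ` into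
`L²` (`memLp_of_integral_truncScore_sq_le`), and then they converge to `V_eff`; so equality also
holds when `V_eff = ∞`.

The small experiment. `V_eff` splits into `ρ₂⁻¹` and `(1 - ρ₂)⁻¹` times second moments that depend
only on the two conditional laws, so `ρ₂ V_eff` keeps the first of these in the limit. -/

theorem measurableSet_arm (q : Fin 3) : MeasurableSet {w : Record 𝒳 | w.1 = q} :=
  measurable_fst (measurableSet_singleton q)

theorem measurableSet_obs : MeasurableSet {w : Record 𝒳 | w.1 ≠ 2} :=
  (measurableSet_arm 2).compl

theorem measurable_covariate : Measurable fun w : Record 𝒳 => w.2.1 :=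
  measurable_fst.comp measurable_snd

/-- The mass of the records in arm `q`, as a measure on the covariate space. -/
def armX (P : Measure (Record 𝒳)) (q : Fin 3) : Measure 𝒳 :=
  (P.restrict {w | w.1 = q}).map fun w => w.2.1

/-- The density of `armX P q` with respect to `obsX P`. -/
def armWeight (P : Measure (Record 𝒳)) (q : Fin 3) (x : 𝒳) : ℝ :=
  ![(1 - rho P 2) * (1 - propensity P x), (1 - rho P 2) * propensity P x,
    rho P 2 * likRatio P x] q

theorem map_mk_lawXY (P : Measure (Record 𝒳)) (q : Fin 3) :
    (lawXY P q).map (Prod.mk q) = ProbabilityTheory.cond P {w | w.1 = q} := by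
  unfold lawXY
  rw [Measure.map_map measurable_prodMk_left measurable_snd]
  conv_rhs => rw [← Measure.map_id (μ := ProbabilityTheory.cond P {w | w.1 = q})]
  refine Measure.map_congr ?_
  have h : ∀ᵐ w ∂(ProbabilityTheory.cond P {w : Record 𝒳 | w.1 = q}), w.1 = q :=
    ae_cond_mem (measurableSet_arm q)
  filter_upwards [h] with w hw
  exact Prod.ext hw.symm rfl

theorem restrict_arm_eq (P : Measure (Record 𝒳)) [IsFiniteMeasure P] (q : Fin 3) :
    P.restrict {w | w.1 = q} = P {w | w.1 = q} • (lawXY P q).map (Prod.mk q) := by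
  rw [map_mk_lawXY, ProbabilityTheory.cond, smul_smul]
  by_cases h : P {w | w.1 = q} = 0
  · rw [Measure.restrict_eq_zero.2 h, smul_zero]
  · rw [ENNReal.mul_inv_cancel h (measure_ne_top _ _), one_smul]

theorem ae_lawXY {P : Measure (Record 𝒳)} {p : Record 𝒳 → Prop}
    (h : ∀ᵐ w ∂P, p w) (q : Fin 3) : ∀ᵐ z ∂(lawXY P q), p (q, z) := by
  rw [← (measurableEmbedding_prodMk_left q).ae_map_iff, map_mk_lawXY]
  exact cond_absolutelyContinuous h

theorem ae_condKernel {μ : Measure (𝒳 × ℝ)} [IsFiniteMeasure μ] {p : 𝒳 × ℝ → Prop}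
    (h : ∀ᵐ z ∂μ, p z) : ∀ᵐ x ∂μ.fst, ∀ᵐ y ∂(μ.condKernel x), p (x, y) := by
  refine Measure.ae_ae_of_ae_compProd ?_
  rwa [μ.disintegrate μ.condKernel]

theorem integrable_cond_iff {P : Measure (Record 𝒳)} [IsFiniteMeasure P] {s : Set (Record 𝒳)}
    (hs : P s ≠ 0) {f : Record 𝒳 → ℝ} :
    Integrable f (ProbabilityTheory.cond P s) ↔ IntegrableOn f s P := by
  rw [ProbabilityTheory.cond,
    integrable_smul_measure (ENNReal.inv_ne_zero.2 (measure_ne_top _ _))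
      (ENNReal.inv_ne_top.2 hs)]
  rfl

theorem integral_cond (P : Measure (Record 𝒳)) (s : Set (Record 𝒳)) (f : Record 𝒳 → ℝ) :
    ∫ w, f w ∂(ProbabilityTheory.cond P s) = (P.real s)⁻¹ * ∫ w in s, f w ∂P := by
  rw [ProbabilityTheory.cond, integral_smul_measure, ENNReal.toReal_inv]
  rfl

theorem integrable_lawXY_iff {P : Measure (Record 𝒳)} [IsFiniteMeasure P] {f : Record 𝒳 → ℝ}
    {q : Fin 3} (hq : P {w | w.1 = q} ≠ 0) :
    Integrable (fun z => f (q, z)) (lawXY P q) ↔ IntegrableOn f {w | w.1 = q} P := by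
  rw [← integrable_cond_iff hq, ← map_mk_lawXY,
    (measurableEmbedding_prodMk_left q).integrable_map_iff]
  rfl

theorem setIntegral_arm (P : Measure (Record 𝒳)) [IsFiniteMeasure P] (q : Fin 3)
    (f : Record 𝒳 → ℝ) :
    ∫ w in {w | w.1 = q}, f w ∂P = rho P q * ∫ z, f (q, z) ∂(lawXY P q) := by
  rw [restrict_arm_eq, integral_smul_measure, (measurableEmbedding_prodMk_left q).integral_map]
  rfl

theorem integral_eq_sum_arm {P : Measure (Record 𝒳)} {f : Record 𝒳 → ℝ} (hf : Integrable f P) :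
    ∫ w, f w ∂P = ∑ q, ∫ w in {w | w.1 = q}, f w ∂P := by
  rw [← integral_iUnion_fintype (fun q => measurableSet_arm q) _ fun q => hf.integrableOn]
  · rw [show (⋃ q : Fin 3, {w : Record 𝒳 | w.1 = q}) = Set.univ by ext w; simp,
      setIntegral_univ]
  · intro q r hqr
    exact Set.disjoint_left.2 fun w (h : w.1 = q) (h' : w.1 = r) => hqr (h.symm.trans h')

theorem smul_fst_lawXY (P : Measure (Record 𝒳)) [IsFiniteMeasure P] (q : Fin 3) :
    P {w | w.1 = q} • (lawXY P q).fst = armX P q := by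
  rw [armX, restrict_arm_eq, Measure.map_smul,
    Measure.map_map measurable_covariate measurable_prodMk_left]
  rfl

theorem rctX_eq_fst (P : Measure (Record 𝒳)) : rctX P = (lawXY P 2).fst := by
  unfold rctX rctLaw lawXY Measure.fst
  rw [Measure.map_map measurable_fst measurable_snd]
  rfl

theorem measurable_condMean (P : Measure (Record 𝒳)) (q : Fin 3) : Measurable (condMean P q) :=
  (StronglyMeasurable.integral_kernel (κ := (lawXY P q).condKernel)
    (f := fun y : ℝ => y) stronglyMeasurable_id).measurable

theorem measurable_contrast (P : Measure (Record 𝒳)) : Measurable (contrast P) :=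
  (measurable_condMean P 1).sub (measurable_condMean P 0)

theorem measurable_propensity (P : Measure (Record 𝒳)) : Measurable (propensity P) :=
  (Measure.measurable_rnDeriv _ _).ennreal_toReal

theorem measurable_likRatio (P : Measure (Record 𝒳)) : Measurable (likRatio P) :=
  (Measure.measurable_rnDeriv _ _).ennreal_toReal

theorem measurable_armWeight (P : Measure (Record 𝒳)) (q : Fin 3) :
    Measurable (armWeight P q) := by
  have h1 := measurable_propensity P
  have h2 := measurable_likRatio P
  unfold armWeight
  fin_cases q <;> simp <;> fun_prop

/-- All arms have positive mass, and the covariate laws of the experimental and of the two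
observational arms are dominated by, respectively equivalent to, the observational one. -/
structure Overlap (P : Measure (Record 𝒳)) : Prop where
  arm_ne_zero : ∀ q : Fin 3, P {w | w.1 = q} ≠ 0
  dominated : rctX P ≪ obsX P
  propensity_mem : ∀ᵐ x ∂(obsX P), 0 < propensity P x ∧ propensity P x < 1

theorem Overlap.obs_ne_zero {P : Measure (Record 𝒳)} (h : Overlap P) : P {w | w.1 ≠ 2} ≠ 0 := fun h0 =>
  h.arm_ne_zero 0 (measure_mono_null (fun w (hw : w.1 = 0) => by simp [hw]) h0)

theorem map_restrict_obsLaw {P : Measure (Record 𝒳)} {q : Fin 3} (hq : q ≠ 2) :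
    ((obsLaw P).restrict {w | w.1 = q}).map (fun w => w.2.1)
      = (P {w | w.1 ≠ 2})⁻¹ • armX P q := by
  rw [obsLaw, ProbabilityTheory.cond, Measure.restrict_smul,
    Measure.restrict_restrict (measurableSet_arm q), Measure.map_smul, armX]
  congr 4
  ext w
  simp only [Set.mem_inter_iff, Set.mem_ofPred_eq, ne_eq, and_iff_left_iff_imp]
  exact fun h => h ▸ hq

theorem obsX_eq_add {P : Measure (Record 𝒳)} : obsX P
    = ((obsLaw P).restrict {w | w.1 = 0}).map (fun w => w.2.1)
      + ((obsLaw P).restrict {w | w.1 = 1}).map (fun w => w.2.1) := by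
  rw [← Measure.map_add _ _ measurable_covariate,
    ← Measure.restrict_union _ (measurableSet_arm 1), obsX]
  · congr 1
    conv_lhs => rw [obsLaw, ProbabilityTheory.cond]
    conv_rhs => rw [obsLaw, ProbabilityTheory.cond, Measure.restrict_smul,
      Measure.restrict_restrict ((measurableSet_arm 0).union (measurableSet_arm 1))]
    congr 2
    ext w
    simp only [Set.mem_inter_iff, Set.mem_union, Set.mem_ofPred_eq]
    generalize w.1 = a
    revert a
    decide
  · exact Set.disjoint_left.2 fun w (h : w.1 = 0) (h' : w.1 = 1) => by simp [h] at h'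

section

variable {P : Measure (Record 𝒳)} [IsProbabilityMeasure P]

theorem real_obs : P.real {w | w.1 ≠ 2} = 1 - rho P 2 := by
  rw [rho, ← probReal_compl_eq_one_sub (measurableSet_arm 2)]
  rfl

theorem Overlap.rho_pos (h : Overlap P) (q : Fin 3) : 0 < rho P q :=
  ENNReal.toReal_pos (h.arm_ne_zero q) (measure_ne_top _ _)

theorem Overlap.one_sub_rho_pos (h : Overlap P) : 0 < 1 - rho P 2 := by
  rw [← real_obs]
  exact ENNReal.toReal_pos h.obs_ne_zero (measure_ne_top _ _)

theorem Overlap.isProbabilityMeasure_obsLaw (h : Overlap P) : IsProbabilityMeasure (obsLaw P) :=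
  cond_isProbabilityMeasure h.obs_ne_zero

theorem Overlap.isProbabilityMeasure_rctLaw (h : Overlap P) : IsProbabilityMeasure (rctLaw P) :=
  cond_isProbabilityMeasure (h.arm_ne_zero 2)

instance : IsFiniteMeasure (obsX P) := by
  unfold obsX obsLaw
  infer_instance

theorem Overlap.obs_one_eq (h : Overlap P) :
    ((obsLaw P).restrict {w | w.1 = 1}).map (fun w => w.2.1)
      = (obsX P).withDensity fun x => ENNReal.ofReal (propensity P x) := by
  have := h.isProbabilityMeasure_obsLaw
  set π := ((obsLaw P).restrict {w | w.1 = 1}).map (fun w => w.2.1) with hπ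
  have hac : π ≪ obsX P := by
    rw [obsX_eq_add, add_comm]
    exact Measure.absolutelyContinuous_of_le (Measure.le_add_right le_rfl)
  rw [← Measure.withDensity_rnDeriv_eq π (obsX P) hac]
  refine withDensity_congr_ae ?_
  filter_upwards [Measure.rnDeriv_lt_top π (obsX P)] with x hx
  rw [propensity, ENNReal.ofReal_toReal hx.ne]

/-- The arm-1 part can be cancelled from both decompositions of `obsX P` because it is a finite
measure. -/
theorem Overlap.obs_zero_eq (h : Overlap P) :
    ((obsLaw P).restrict {w | w.1 = 0}).map (fun w => w.2.1)
      = (obsX P).withDensity fun x => ENNReal.ofReal (1 - propensity P x) := by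
  have := h.isProbabilityMeasure_obsLaw
  have h1 := h.obs_one_eq
  have hadd := obsX_eq_add (P := P)
  ext s hs
  have e1 : obsX P s = (obsX P).withDensity (fun x => ENNReal.ofReal (1 - propensity P x)) s
      + ((obsLaw P).restrict {w | w.1 = 1}).map (fun w => w.2.1) s := by
    rw [h1, withDensity_apply _ hs, withDensity_apply _ hs, ← lintegral_add_right _
      (measurable_propensity P).ennreal_ofReal, ← setLIntegral_one]
    refine setLIntegral_congr_fun_ae hs ?_
    filter_upwards [h.propensity_mem] with x hx _
    rw [← ENNReal.ofReal_add (by linarith [hx.2]) hx.1.le]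
    simp
  have e2 : obsX P s = ((obsLaw P).restrict {w | w.1 = 0}).map (fun w => w.2.1) s
      + ((obsLaw P).restrict {w | w.1 = 1}).map (fun w => w.2.1) s := by
    conv_lhs => rw [hadd]
    rfl
  exact (ENNReal.add_left_inj (measure_ne_top _ s)).1 (e2.symm.trans e1)

/-- One reference measure for all three arms lets their contributions at the same covariate value be
added, and cancelled, pointwise. -/
theorem Overlap.armX_eq (h : Overlap P) (q : Fin 3) :
    armX P q = (obsX P).withDensity fun x => ENNReal.ofReal (armWeight P q x) := by
  have hobs : ENNReal.ofReal (1 - rho P 2) = P {w | w.1 ≠ 2} := by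
    rw [← real_obs]; exact ofReal_measureReal
  have key : ∀ {q : Fin 3}, q ≠ 2 → armX P q = ENNReal.ofReal (1 - rho P 2) •
      ((obsLaw P).restrict {w | w.1 = q}).map (fun w => w.2.1) := fun hq => by
    rw [map_restrict_obsLaw hq, smul_smul, hobs,
      ENNReal.mul_inv_cancel h.obs_ne_zero (measure_ne_top _ _), one_smul]
  have h0 := h.one_sub_rho_pos.le
  fin_cases q
  · change armX P 0 = _
    rw [key (by decide), h.obs_zero_eq, ← withDensity_smul _ (by
      exact ((measurable_propensity P).const_sub 1).ennreal_ofReal)]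
    congr 1; ext x
    exact (ENNReal.ofReal_mul h0).symm
  · change armX P 1 = _
    rw [key (by decide), h.obs_one_eq, ← withDensity_smul _ (measurable_propensity P).ennreal_ofReal]
    congr 1; ext x
    exact (ENNReal.ofReal_mul h0).symm
  · change armX P 2 = _
    have := h.isProbabilityMeasure_obsLaw
    have : IsFiniteMeasure (rctX P) := by unfold rctX rctLaw; infer_instance
    rw [← smul_fst_lawXY, ← rctX_eq_fst, ← Measure.withDensity_rnDeriv_eq _ _ h.dominated,
      ← withDensity_smul _ (Measure.measurable_rnDeriv _ _)]
    refine withDensity_congr_ae ?_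
    filter_upwards [Measure.rnDeriv_lt_top (rctX P) (obsX P)] with x hx
    change P {w | w.1 = 2} * _ = ENNReal.ofReal (rho P 2 * likRatio P x)
    rw [ENNReal.ofReal_mul (h.rho_pos 2).le, likRatio, ENNReal.ofReal_toReal hx.ne, rho,
      ofReal_measureReal]

theorem Overlap.armWeight_nonneg (h : Overlap P) (q : Fin 3) :
    ∀ᵐ x ∂(obsX P), 0 ≤ armWeight P q x := by
  have h0 := h.one_sub_rho_pos.le
  filter_upwards [h.propensity_mem] with x hx
  fin_cases q
  · exact mul_nonneg h0 (by linarith [hx.2])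
  · exact mul_nonneg h0 hx.1.le
  · exact mul_nonneg (h.rho_pos 2).le ENNReal.toReal_nonneg

/-- Strict positivity of `r` and `1 - r` makes the density of either observational arm nonzero.
Statements about the conditional kernels of these arms thus hold at `obsX P`-almost every `x`, where
`Δ` is needed. -/
theorem Overlap.obsX_ac (h : Overlap P) {q : Fin 3} (hq : q ≠ 2) :
    obsX P ≪ (lawXY P q).fst := by
  have h1 : obsX P ≪ armX P q := by
    rw [h.armX_eq]
    refine withDensity_absolutelyContinuous' (measurable_armWeight P q).ennreal_ofReal.aemeasurable ?_
    filter_upwards [h.propensity_mem] with x hx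
    have h0 := h.one_sub_rho_pos
    rw [ne_eq, ENNReal.ofReal_eq_zero, not_le]
    fin_cases q
    · exact mul_pos h0 (by linarith [hx.2])
    · exact mul_pos h0 hx.1
    · exact absurd rfl hq
  refine h1.trans ?_
  rw [← smul_fst_lawXY]
  exact Measure.smul_absolutelyContinuous

theorem Overlap.ae_of_ae_obsX (h : Overlap P) {p : 𝒳 → Prop} (hp : ∀ᵐ x ∂(obsX P), p x) :
    ∀ᵐ w ∂P, p w.2.1 := by
  have h1 : ∀ q : Fin 3, ∀ᵐ w ∂P, w.1 = q → p w.2.1 := fun q => by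
    refine (ae_restrict_iff' (measurableSet_arm q)).1 ?_
    have : ∀ᵐ x ∂(armX P q), p x := by
      rw [h.armX_eq]
      exact withDensity_absolutelyContinuous _ _ hp
    exact ae_of_ae_map measurable_covariate.aemeasurable this
  filter_upwards [ae_all_iff.2 h1] with w hw using hw _ rfl

theorem Overlap.integral_fst_lawXY (h : Overlap P) (q : Fin 3) (f : 𝒳 → ℝ) :
    rho P q * ∫ x, f x ∂(lawXY P q).fst = ∫ x, armWeight P q x * f x ∂(obsX P) := by
  have h1 : rho P q * ∫ x, f x ∂(lawXY P q).fst = ∫ x, f x ∂(armX P q) := by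
    rw [← smul_fst_lawXY, integral_smul_measure]
    rfl
  rw [h1, h.armX_eq, integral_withDensity_eq_integral_toReal_smul
    (measurable_armWeight P q).ennreal_ofReal (by simp)]
  refine integral_congr_ae ?_
  filter_upwards [h.armWeight_nonneg q] with x hx
  rw [ENNReal.toReal_ofReal hx, smul_eq_mul]

theorem Overlap.integrable_fst_lawXY (h : Overlap P) {q : Fin 3} {f : 𝒳 → ℝ}
    (hf : Integrable f (lawXY P q).fst) :
    Integrable (fun x => armWeight P q x * f x) (obsX P) := by
  have h1 : Integrable f (armX P q) := by
    rw [← smul_fst_lawXY]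
    exact hf.smul_measure (measure_ne_top _ _)
  rw [h.armX_eq, integrable_withDensity_iff_integrable_smul'
    (measurable_armWeight P q).ennreal_ofReal (by simp)] at h1
  refine h1.congr ?_
  filter_upwards [h.armWeight_nonneg q] with x hx
  rw [ENNReal.toReal_ofReal hx, smul_eq_mul]

/-- Fubini within each arm, followed by the change of covariate measure to `obsX P`. -/
theorem Overlap.integral_eq (h : Overlap P) {f : Record 𝒳 → ℝ} (hf : Integrable f P) :
    ∫ w, f w ∂P = ∫ x, ∑ q, armWeight P q x *
      ∫ y, f (q, x, y) ∂((lawXY P q).condKernel x) ∂(obsX P) := by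
  have hi : ∀ q, Integrable (fun z => f (q, z)) (lawXY P q) := fun q =>
    (integrable_lawXY_iff (h.arm_ne_zero q)).2 hf.integrableOn
  rw [integral_eq_sum_arm hf, integral_finsetSum _ fun q _ =>
    h.integrable_fst_lawXY (hi q).integral_condKernel]
  refine Finset.sum_congr rfl fun q _ => ?_
  rw [setIntegral_arm, ← h.integral_fst_lawXY, Measure.integral_condKernel (hi q)]

/-- The conditional expectations given the covariate inside the arms are integrals over the
conditional kernels, so a function whose weighted sum of those vanishes has mean zero. -/
theorem Overlap.integral_eq_zero (h : Overlap P) {f : Record 𝒳 → ℝ} (hf : Integrable f P)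
    (h0 : ∀ᵐ x ∂(obsX P), ∑ q, armWeight P q x *
      ∫ y, f (q, x, y) ∂((lawXY P q).condKernel x) = 0) : ∫ w, f w ∂P = 0 := by
  rw [h.integral_eq hf, integral_congr_ae h0]
  simp

end

/-! ### Difference quotients along sequences -/

/-- Conditional means and dominations are controlled only almost everywhere, with an exceptional set
that may depend on `θ`. Along a sequence there are countably many such sets, so their union is still
null. -/
theorem hasDerivAt_zero_of_seq {f : ℝ → ℝ} {d ε : ℝ} (hε : 0 < ε)
    (h : ∀ u : ℕ → ℝ, (∀ n, |u n| < ε ∧ u n ≠ 0) → Tendsto u atTop (𝓝 0) →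
      Tendsto (fun n => (f (u n) - f 0) / u n) atTop (𝓝 d)) : HasDerivAt f d 0 := by
  rw [hasDerivAt_iff_tendsto_slope]
  refine tendsto_of_seq_tendsto fun u hu => ?_
  have hu0 := tendsto_nhdsWithin_iff.1 hu
  have hsmall : ∀ᶠ n in atTop, |u n| < ε := by
    have := hu0.1.abs
    rw [abs_zero] at this
    exact this.eventually (gt_mem_nhds hε)
  obtain ⟨N, hN⟩ := eventually_atTop.1 (hsmall.and hu0.2)
  rw [← tendsto_add_atTop_iff_nat N]
  refine (h (fun n => u (n + N)) (fun n => ⟨(hN _ (by omega)).1, (hN _ (by omega)).2⟩)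
    ((tendsto_add_atTop_iff_nat N).2 hu0.1)).congr fun n => ?_
  simp [slope_def_field]

theorem tendsto_of_tendsto_slope {a u : ℕ → ℝ} {a₀ b : ℝ} (hu : ∀ n, u n ≠ 0)
    (hu0 : Tendsto u atTop (𝓝 0)) (h : Tendsto (fun n => (a n - a₀) / u n) atTop (𝓝 b)) :
    Tendsto a atTop (𝓝 a₀) := by
  have h1 := (h.mul hu0).add_const a₀
  simp only [mul_zero, zero_add] at h1
  refine h1.congr fun n => ?_
  rw [div_mul_cancel₀ _ (hu n), sub_add_cancel]

/-- The chain rule along a sequence. Using `dslope` covers the indices with `a n = a₀`, where the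
ordinary difference quotient of `f` would divide by zero. -/
theorem tendsto_slope_comp {f : ℝ → ℝ} {a u : ℕ → ℝ} {a₀ b f' : ℝ} (hf : HasDerivAt f f' a₀)
    (hu : ∀ n, u n ≠ 0) (hu0 : Tendsto u atTop (𝓝 0))
    (h : Tendsto (fun n => (a n - a₀) / u n) atTop (𝓝 b)) :
    Tendsto (fun n => (f (a n) - f a₀) / u n) atTop (𝓝 (f' * b)) := by
  have h1 : Tendsto (fun n => dslope f a₀ (a n)) atTop (𝓝 f') := by
    have := (continuousAt_dslope_same.2 hf.differentiableAt).tendsto.comp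
      (tendsto_of_tendsto_slope hu hu0 h)
    rwa [dslope_same, hf.deriv] at this
  refine (h1.mul h).congr fun n => ?_
  rw [← sub_smul_dslope f a₀ (a n), smul_eq_mul]
  ring

theorem tendsto_slope_mul {a b u : ℕ → ℝ} {a₀ b₀ a' b' : ℝ}
    (hu : ∀ n, u n ≠ 0) (hu0 : Tendsto u atTop (𝓝 0))
    (ha : Tendsto (fun n => (a n - a₀) / u n) atTop (𝓝 a'))
    (hb : Tendsto (fun n => (b n - b₀) / u n) atTop (𝓝 b')) :
    Tendsto (fun n => (a n * b n - a₀ * b₀) / u n) atTop (𝓝 (a' * b₀ + a₀ * b')) := by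
  refine ((ha.mul (tendsto_of_tendsto_slope hu hu0 hb)).add (hb.const_mul a₀)).congr fun n => ?_
  ring

/-- The integrability of `D` is a conclusion: `|D|` is a limit of quotients bounded by `B`. -/
theorem tendsto_slope_integral {α : Type*} [MeasurableSpace α] {μ : Measure α} {F : ℕ → α → ℝ}
    {F₀ D B : α → ℝ} {u : ℕ → ℝ} (hu : ∀ n, u n ≠ 0)
    (hF : ∀ n, AEStronglyMeasurable (F n) μ) (h0 : Integrable F₀ μ) (hB : Integrable B μ)
    (hb : ∀ n, ∀ᵐ x ∂μ, |F n x - F₀ x| ≤ B x * |u n|)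
    (hD : ∀ᵐ x ∂μ, Tendsto (fun n => (F n x - F₀ x) / u n) atTop (𝓝 (D x))) :
    Integrable D μ ∧
      Tendsto (fun n => (∫ x, F n x ∂μ - ∫ x, F₀ x ∂μ) / u n) atTop (𝓝 (∫ x, D x ∂μ)) := by
  have hm : ∀ n, AEStronglyMeasurable (fun x => (F n x - F₀ x) / u n) μ := fun n =>
    (((hF n).sub h0.1).mul_const (u n)⁻¹).congr (by simp [div_eq_mul_inv])
  have hle : ∀ n, ∀ᵐ x ∂μ, ‖(F n x - F₀ x) / u n‖ ≤ B x := fun n => by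
    filter_upwards [hb n] with x hx
    rwa [Real.norm_eq_abs, abs_div, div_le_iff₀ (abs_pos.2 (hu n))]
  have hint : ∀ n, Integrable (F n) μ := fun n => by
    have h1 : Integrable (fun x => (F n x - F₀ x) / u n) μ := hB.mono' (hm n) (hle n)
    refine ((h1.mul_const (u n)).add h0).congr (Eventually.of_forall fun x => ?_)
    simp only [Pi.add_apply]
    rw [div_mul_cancel₀ _ (hu n), sub_add_cancel]
  refine ⟨?_, ?_⟩
  · refine hB.mono' (aestronglyMeasurable_of_tendsto_ae _ hm hD) ?_
    filter_upwards [hD, ae_all_iff.2 hle] with x hx hx'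
    exact le_of_tendsto hx.norm (Eventually.of_forall hx')
  · refine (tendsto_integral_of_dominated_convergence B hm hB hle hD).congr fun n => ?_
    rw [integral_div, integral_sub (hint n) h0]

/-! ### Tilted laws -/

section

variable {P : Measure (Record 𝒳)} {p : ℝ → Record 𝒳 → ℝ} {θ : ℝ}

theorem tilt_zero (h : ∀ᵐ w ∂P, p 0 w = 1) : tilt P p 0 = P := by
  have : (fun w => ENNReal.ofReal (p 0 w)) =ᵐ[P] 1 := by
    filter_upwards [h] with w hw
    simp [hw]
  rw [tilt, withDensity_congr_ae this, withDensity_one]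

theorem setIntegral_tilt (hm : Measurable (p θ)) (hpos : ∀ᵐ w ∂P, 0 < p θ w)
    {s : Set (Record 𝒳)} (hs : MeasurableSet s) (f : Record 𝒳 → ℝ) :
    ∫ w in s, f w ∂(tilt P p θ) = ∫ w in s, f w * p θ w ∂P := by
  rw [tilt, restrict_withDensity hs, integral_withDensity_eq_integral_toReal_smul
    hm.ennreal_ofReal (by simp)]
  refine integral_congr_ae ?_
  filter_upwards [ae_restrict_of_ae hpos] with w hw
  rw [ENNReal.toReal_ofReal hw.le, smul_eq_mul, mul_comm]

theorem integrableOn_tilt_iff (hm : Measurable (p θ)) (hpos : ∀ᵐ w ∂P, 0 < p θ w)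
    {s : Set (Record 𝒳)} (hs : MeasurableSet s) {f : Record 𝒳 → ℝ} :
    IntegrableOn f s (tilt P p θ) ↔ IntegrableOn (fun w => f w * p θ w) s P := by
  rw [IntegrableOn, tilt, restrict_withDensity hs,
    integrable_withDensity_iff_integrable_smul' hm.ennreal_ofReal (by simp)]
  refine integrable_congr ?_
  filter_upwards [ae_restrict_of_ae hpos] with w hw
  rw [ENNReal.toReal_ofReal hw.le, smul_eq_mul, mul_comm]

theorem tilt_ne_zero (hm : Measurable (p θ)) (hpos : ∀ᵐ w ∂P, 0 < p θ w)
    {s : Set (Record 𝒳)} (hs : P s ≠ 0) : tilt P p θ s ≠ 0 := fun h0 =>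
  hs <| withDensity_absolutelyContinuous' hm.ennreal_ofReal.aemeasurable
    (by filter_upwards [hpos] with w hw using by simpa using hw) h0

variable [IsProbabilityMeasure P] [IsProbabilityMeasure (tilt P p θ)]

theorem setIntegral_lawXY_tilt (hm : Measurable (p θ)) (hpos : ∀ᵐ w ∂P, 0 < p θ w) (q : Fin 3)
    {s : Set (𝒳 × ℝ)} (hs : MeasurableSet s) (f : 𝒳 × ℝ → ℝ) :
    rho (tilt P p θ) q * ∫ z in s, f z ∂(lawXY (tilt P p θ) q)
      = rho P q * ∫ z in s, f z * p θ (q, z) ∂(lawXY P q) := by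
  rw [← integral_indicator hs, ← integral_indicator hs,
    ← setIntegral_arm (tilt P p θ) q fun w => s.indicator f w.2,
    setIntegral_tilt hm hpos (measurableSet_arm q), setIntegral_arm]
  congr 2 with z
  by_cases hz : z ∈ s <;> simp [hz]

theorem integrable_lawXY_tilt_iff (hm : Measurable (p θ)) (hpos : ∀ᵐ w ∂P, 0 < p θ w) {q : Fin 3}
    (hq : P {w | w.1 = q} ≠ 0) {f : 𝒳 × ℝ → ℝ} :
    Integrable f (lawXY (tilt P p θ) q) ↔
      Integrable (fun z => f z * p θ (q, z)) (lawXY P q) := by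
  rw [integrable_lawXY_iff (f := fun w => f w.2) (tilt_ne_zero hm hpos hq),
    integrableOn_tilt_iff hm hpos (measurableSet_arm q), ← integrable_lawXY_iff hq]

/-- Bayes' formula for the conditional mean. Over any covariate set, both sides integrate, up to the
arm masses, to the integral of `y` under the tilted arm law, so they agree almost everywhere. The
product form needs no lower bound on the normaliser. -/
theorem condMean_tilt_mul (hm : Measurable (p θ)) (hpos : ∀ᵐ w ∂P, 0 < p θ w) {q : Fin 3}
    (hq : P {w | w.1 = q} ≠ 0) (hy : IntegrableOn (fun w => w.2.2 * p θ w) {w | w.1 = q} P) :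
    ∀ᵐ x ∂(lawXY P q).fst,
      condMean (tilt P p θ) q x * ∫ y, p θ (q, x, y) ∂((lawXY P q).condKernel x)
        = ∫ y, y * p θ (q, x, y) ∂((lawXY P q).condKernel x) := by
  set m := condMean (tilt P p θ) q with hmdef
  have hy2 : Integrable (fun z : 𝒳 × ℝ => z.2 * p θ (q, z)) (lawXY P q) :=
    (integrable_lawXY_iff (f := fun w => w.2.2 * p θ w) hq).2 hy
  have hy1 : Integrable (fun z : 𝒳 × ℝ => z.2) (lawXY (tilt P p θ) q) :=
    (integrable_lawXY_tilt_iff hm hpos hq).2 hy2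
  have hm1 : Integrable (fun z : 𝒳 × ℝ => m z.1) (lawXY (tilt P p θ) q) :=
    hy1.integral_condKernel.comp_measurable measurable_fst
  have hm2 : Integrable (fun z : 𝒳 × ℝ => m z.1 * p θ (q, z)) (lawXY P q) :=
    (integrable_lawXY_tilt_iff hm hpos hq).1 hm1
  have hI1 := hm2.integral_condKernel
  simp only [integral_const_mul] at hI1
  refine Integrable.ae_eq_of_forall_setIntegral_eq _ _ hI1 hy2.integral_condKernel ?_
  intro s hs _
  have hT : MeasurableSet (s ×ˢ (Set.univ : Set ℝ)) := hs.prod .univ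
  -- The factor `rho P q` is inserted because `setIntegral_lawXY_tilt` compares the two arm laws
  -- only after weighting each with its arm mass.
  have hρ : rho P q ≠ 0 := (ENNReal.toReal_pos hq (measure_ne_top _ _)).ne'
  refine mul_left_cancel₀ hρ ?_
  have e1 := Measure.setIntegral_condKernel_univ_right hs hm2.integrableOn
  have e2 := Measure.setIntegral_condKernel_univ_right hs hy2.integrableOn
  have e3 := Measure.setIntegral_condKernel_univ_right hs hm1.integrableOn
  have e4 := Measure.setIntegral_condKernel_univ_right hs hy1.integrableOn
  simp only [integral_const_mul] at e1
  simp only [integral_const, probReal_univ, one_smul] at e3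
  rw [e1, e2, ← setIntegral_lawXY_tilt hm hpos q hT (fun z => m z.1),
    ← setIntegral_lawXY_tilt hm hpos q hT (fun z => z.2), ← e3, ← e4]
  rfl

end

/-! ### Moments along a smooth submodel -/

/-- The derivative of `condMean (P_θ) q x` at `θ = 0` along a submodel with score `s`. -/
def condMeanDeriv (P : Measure (Record 𝒳)) (s : Record 𝒳 → ℝ) (q : Fin 3) (x : 𝒳) : ℝ :=
  (∫ y, y * s (q, x, y) ∂((lawXY P q).condKernel x))
    - condMean P q x * ∫ y, s (q, x, y) ∂((lawXY P q).condKernel x)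

/-- The derivative of `contrast (P_θ) x` at `θ = 0` along a submodel with score `s`. -/
def contrastDeriv (P : Measure (Record 𝒳)) (s : Record 𝒳 → ℝ) (x : 𝒳) : ℝ :=
  condMeanDeriv P s 1 x - condMeanDeriv P s 0 x

theorem DominatedQuotients.integrable {P : Measure (Record 𝒳)} {ε θ : ℝ}
    {F : ℝ → Record 𝒳 → ℝ} (hF : DominatedQuotients P ε F) (hθ : |θ| < ε)
    (hm : AEStronglyMeasurable (F θ) P) (h0 : Integrable (F 0) P) : Integrable (F θ) P := by
  obtain ⟨B, hB, hb⟩ := hF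
  have h1 : Integrable (fun w => F θ w - F 0 w) P :=
    (hB.mul_const |θ|).mono' (hm.sub h0.1) (hb θ hθ)
  exact (h1.add h0).congr (Eventually.of_forall fun w => sub_add_cancel (F θ w) (F 0 w))

theorem DominatedQuotients.hasDerivAt_integral {P : Measure (Record 𝒳)} {ε : ℝ}
    {F : ℝ → Record 𝒳 → ℝ} {D : Record 𝒳 → ℝ} (hε : 0 < ε) (hF : DominatedQuotients P ε F)
    (hm : ∀ θ, |θ| < ε → AEStronglyMeasurable (F θ) P) (h0 : Integrable (F 0) P)
    (hD : ∀ u : ℕ → ℝ, (∀ n, |u n| < ε ∧ u n ≠ 0) → Tendsto u atTop (𝓝 0) →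
      ∀ᵐ w ∂P, Tendsto (fun n => (F (u n) w - F 0 w) / u n) atTop (𝓝 (D w))) :
    Integrable D P ∧ HasDerivAt (fun θ => ∫ w, F θ w ∂P) (∫ w, D w ∂P) 0 := by
  obtain ⟨B, hB, hb⟩ := hF
  have key : ∀ u : ℕ → ℝ, (∀ n, |u n| < ε ∧ u n ≠ 0) → Tendsto u atTop (𝓝 0) → _ :=
    fun u hu hu0 => tendsto_slope_integral (fun n => (hu n).2) (fun n => hm _ (hu n).1) h0 hB
      (fun n => hb _ (hu n).1) (hD u hu hu0)
  refine ⟨?_, hasDerivAt_zero_of_seq hε fun u hu hu0 => (key u hu hu0).2⟩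
  -- Integrability of `D` needs just one admissible null sequence; this one is nonzero and stays
  -- below `ε`.
  have hu : ∀ n : ℕ, |ε / 2 / ((n : ℝ) + 1)| < ε ∧ ε / 2 / ((n : ℝ) + 1) ≠ 0 := fun n => by
    have hn : (0 : ℝ) < n + 1 := by positivity
    refine ⟨?_, by positivity⟩
    rw [abs_of_pos (by positivity), div_lt_iff₀ hn]
    nlinarith [(Nat.cast_nonneg n : (0 : ℝ) ≤ n)]
  refine (key _ hu ?_).1
  have := (tendsto_one_div_add_atTop_nhds_zero_nat (𝕜 := ℝ)).const_mul (ε / 2)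
  simpa only [mul_one_div, mul_zero] using this

namespace SmoothSubmodel

variable {ψ : ℝ → Fin k → ℝ} {P : Measure (Record 𝒳)} (M : SmoothSubmodel ψ P)

theorem tilt_zero_eq : tilt P M.p 0 = P := tilt_zero M.p_zero

theorem tendsto_slope_p {u : ℕ → ℝ} (hu : ∀ n, u n ≠ 0) (hu0 : Tendsto u atTop (𝓝 0)) :
    ∀ᵐ w ∂P, Tendsto (fun n => (M.p (u n) w - M.p 0 w) / u n) atTop (𝓝 (M.score w)) := by
  filter_upwards [M.hasDeriv] with w hw
  refine ((hasDerivAt_iff_tendsto_slope.1 hw).comp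
    (tendsto_nhdsWithin_iff.2 ⟨hu0, Eventually.of_forall hu⟩)).congr fun n => ?_
  simp [slope_def_field]

theorem measurable_obs_outcome (θ : ℝ) :
    Measurable fun w : Record 𝒳 => if w.1 ≠ 2 then w.2.2 * M.p θ w else 0 :=
  Measurable.ite measurableSet_obs (measurable_snd.snd.mul (M.measurable_p θ)) measurable_const

theorem integrable_obs_outcome_zero (hY : Integrable (fun w : Record 𝒳 => w.2.2) P) :
    Integrable (fun w : Record 𝒳 => if w.1 ≠ 2 then w.2.2 * M.p 0 w else 0) P := by
  refine hY.mono (M.measurable_obs_outcome 0).aestronglyMeasurable ?_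
  filter_upwards [M.p_zero] with w hw
  split_ifs <;> simp [hw]

theorem integrable_obs_outcome_mul_score (hY : Integrable (fun w : Record 𝒳 => w.2.2) P) :
    Integrable (fun w : Record 𝒳 => if w.1 ≠ 2 then w.2.2 * M.score w else 0) P := by
  refine (M.dom_condMean.hasDerivAt_integral M.ε_pos
    (fun θ _ => (M.measurable_obs_outcome θ).aestronglyMeasurable)
    (M.integrable_obs_outcome_zero hY) fun u hu hu0 => ?_).1
  filter_upwards [M.tendsto_slope_p (fun n => (hu n).2) hu0] with w hw
  split_ifs with h
  · refine (hw.const_mul w.2.2).congr fun n => ?_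
    ring
  · simp

variable [IsProbabilityMeasure P]

theorem integrable_score : Integrable M.score P := M.memLp_score.integrable one_le_two

/-- Within the fibre over `x`, the tilted mean is the quotient of `∫ y p_θ` and `∫ p_θ`. Both are
differentiated by dominated convergence under the conditional kernel, whose dominating functions are
integrable for almost every `x` by disintegration. -/
theorem tendsto_slope_condMean (h : Overlap P) (hY : Integrable (fun w : Record 𝒳 => w.2.2) P)
    {q : Fin 3} (hq : q ≠ 2) {u : ℕ → ℝ} (hu : ∀ n, |u n| < M.ε ∧ u n ≠ 0)
    (hu0 : Tendsto u atTop (𝓝 0)) :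
    ∀ᵐ x ∂(obsX P), Tendsto
      (fun n => (condMean (tilt P M.p (u n)) q x - condMean P q x) / u n) atTop
      (𝓝 (condMeanDeriv P M.score q x)) := by
  obtain ⟨B, hB, hb⟩ := M.dom_mass
  obtain ⟨C, hC, hc⟩ := M.dom_condMean
  have hq' := h.arm_ne_zero q
  have a1 := ae_condKernel (ae_lawXY M.p_zero q)
  have a2 := ae_condKernel (ae_lawXY (M.tendsto_slope_p (fun n => (hu n).2) hu0) q)
  have a3 := ae_all_iff.2 fun n => ae_condKernel (ae_lawXY (hb (u n) (hu n).1) q)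
  have a4 := ae_all_iff.2 fun n => ae_condKernel (ae_lawXY (hc (u n) (hu n).1) q)
  have a5 := ((integrable_lawXY_iff hq').2 hB.integrableOn).condKernel_ae
  have a6 := ((integrable_lawXY_iff hq').2 hC.integrableOn).condKernel_ae
  have a7 := ((integrable_lawXY_iff hq').2 hY.integrableOn).condKernel_ae
  have a8 := ae_all_iff.2 fun n => by
    have := M.isProb (u n) (hu n).1
    refine condMean_tilt_mul (M.measurable_p (u n)) (M.p_pos _ (hu n).1) hq' ?_
    have := M.dom_condMean.integrable (hu n).1
      (M.measurable_obs_outcome (u n)).aestronglyMeasurable (M.integrable_obs_outcome_zero hY)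
    refine this.integrableOn.congr_fun (fun w (hw : w.1 = q) => ?_) (measurableSet_arm q)
    simp [hw, hq]
  refine (h.obsX_ac hq) ?_
  filter_upwards [a1, a2, a3, a4, a5, a6, a7, a8] with x a1 a2 a3 a4 a5 a6 a7 a8
  set κ := (lawXY P q).condKernel x
  have hp : ∀ n, Measurable fun y => M.p (u n) (q, x, y) := fun n =>
    (M.measurable_p _).comp (measurable_prodMk_left.comp measurable_prodMk_left)
  have i1 : (fun y => M.p 0 (q, x, y)) =ᵐ[κ] fun _ => 1 := a1
  have i2 : (fun y => y * M.p 0 (q, x, y)) =ᵐ[κ] fun y => y := by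
    filter_upwards [a1] with y hy
    rw [hy, mul_one]
  have t1 := (tendsto_slope_integral (fun n => (hu n).2) (fun n => (hp n).aestronglyMeasurable)
    ((integrable_const (1 : ℝ)).congr i1.symm) a5 a3 a2).2
  have t2 := (tendsto_slope_integral (F := fun n y => y * M.p (u n) (q, x, y))
    (D := fun y => y * M.score (q, x, y)) (fun n => (hu n).2)
    (fun n => (measurable_id.mul (hp n)).aestronglyMeasurable)
    (a7.congr i2.symm) a6 (fun n => by simpa [hq] using a4 n) (by
      filter_upwards [a2] with y hy
      refine (hy.const_mul y).congr fun n => ?_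
      ring)).2
  rw [integral_congr_ae i1, integral_const, probReal_univ, one_smul] at t1
  rw [integral_congr_ae i2] at t2
  have t3 := tendsto_of_tendsto_slope (fun n => (hu n).2) hu0 t1
  have t4 := ((t2.sub (t1.const_mul (condMean P q x))).div t3 one_ne_zero)
  rw [div_one] at t4
  refine t4.congr' ?_
  -- The normaliser `∫ p_θ` tends to 1, so it may be divided by for large `n`.
  filter_upwards [t3.eventually_ne one_ne_zero] with n hn
  have e := a8 n
  have hun := (hu n).2
  simp only [Pi.div_apply]
  rw [← e, show (∫ y, y ∂κ) = condMean P q x from rfl]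
  field_simp
  ring

theorem tendsto_slope_contrast (h : Overlap P) (hY : Integrable (fun w : Record 𝒳 => w.2.2) P)
    {u : ℕ → ℝ} (hu : ∀ n, |u n| < M.ε ∧ u n ≠ 0) (hu0 : Tendsto u atTop (𝓝 0)) :
    ∀ᵐ x ∂(obsX P), Tendsto
      (fun n => (contrast (tilt P M.p (u n)) x - contrast P x) / u n) atTop
      (𝓝 (contrastDeriv P M.score x)) := by
  filter_upwards [M.tendsto_slope_condMean h hY (q := 1) (by decide) hu hu0,
    M.tendsto_slope_condMean h hY (q := 0) (by decide) hu hu0] with x h1 h0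
  refine (h1.sub h0).congr fun n => ?_
  unfold contrast
  ring

/-- The common template for `N`, `A`, `G` and `C`: `g` is an arm indicator, possibly times `y`, and
`f` is constant, a component of `ψ`, or a product of two components. -/
theorem hasDerivAt_moment (h : Overlap P) (hY : Integrable (fun w : Record 𝒳 => w.2.2) P)
    {g : Record 𝒳 → ℝ} (hg : Measurable g) {f f' : ℝ → ℝ} (hf : ∀ t, HasDerivAt f (f' t) t)
    (h0 : Integrable (fun w => g w * f (contrast P w.2.1)) P)
    (hdom : DominatedQuotients P M.ε
      fun θ w => g w * f (contrast (tilt P M.p θ) w.2.1) * M.p θ w) :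
    Integrable (fun w => g w * (f (contrast P w.2.1) * M.score w
        + f' (contrast P w.2.1) * contrastDeriv P M.score w.2.1)) P ∧
      HasDerivAt (fun θ => ∫ w, g w * f (contrast (tilt P M.p θ) w.2.1) * M.p θ w ∂P)
        (∫ w, g w * (f (contrast P w.2.1) * M.score w
          + f' (contrast P w.2.1) * contrastDeriv P M.score w.2.1) ∂P) 0 := by
  have hfm : Measurable f := (continuous_iff_continuousAt.2 fun t => (hf t).continuousAt).measurable
  refine hdom.hasDerivAt_integral M.ε_pos (fun θ _ => ?_) ?_ fun u hu hu0 => ?_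
  · exact ((hg.mul (hfm.comp ((measurable_contrast _).comp measurable_covariate))).mul
      (M.measurable_p θ)).aestronglyMeasurable
  · refine h0.congr ?_
    filter_upwards [M.p_zero] with w hw
    rw [hw, M.tilt_zero_eq, mul_one]
  · filter_upwards [M.p_zero, M.tendsto_slope_p (fun n => (hu n).2) hu0,
      h.ae_of_ae_obsX (M.tendsto_slope_contrast h hY hu hu0)] with w w0 w1 w2
    have hu' := fun n => (hu n).2
    have t := (tendsto_slope_mul hu' hu0 (tendsto_slope_comp (hf _) hu' hu0 w2) w1).const_mul (g w)
    rw [w0, mul_one, mul_one, add_comm] at t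
    refine t.congr fun n => ?_
    rw [M.tilt_zero_eq, w0]
    ring

end SmoothSubmodel

/-! ### Differentiability of the estimand along a smooth submodel -/

/-- Since `e` vanishes at 0, the quotient of `f e` is `f` times the quotient of `e`, and continuity
of `f` is enough. -/
theorem hasDerivAt_mul_of_continuousAt {f e : ℝ → ℝ} {e' : ℝ} (hf : ContinuousAt f 0)
    (he : HasDerivAt e e' 0) (h0 : e 0 = 0) : HasDerivAt (fun t => f t * e t) (f 0 * e') 0 := by
  rw [hasDerivAt_iff_tendsto_slope] at he ⊢
  refine ((hf.tendsto.mono_left nhdsWithin_le_nhds).mul he).congr fun t => ?_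
  rw [slope_def_field, slope_def_field, h0]
  ring

/-- The arm mass cancels from `G⁻¹ C`. In the singular case both matrix inverses are zero by
convention, so no invertibility is needed. -/
theorem inv_smul_mulVec_smul {r : ℝ} (hr : r ≠ 0) (A : Matrix (Fin k) (Fin k) ℝ)
    (v : Fin k → ℝ) : (r • A)⁻¹ *ᵥ (r • v) = A⁻¹ *ᵥ v := by
  by_cases hA : IsUnit A.det
  · have := invertibleOfNonzero hr
    rw [Matrix.inv_smul A r hA, Matrix.smul_mulVec, Matrix.mulVec_smul, smul_smul, invOf_mul_self,
      one_smul]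
  · have hB : ¬ IsUnit (r • A).det := by
      rw [isUnit_iff_ne_zero, not_not] at *
      rw [Matrix.det_smul, hA, mul_zero]
    rw [Matrix.nonsing_inv_apply_not_isUnit _ hA, Matrix.nonsing_inv_apply_not_isUnit _ hB,
      Matrix.zero_mulVec, Matrix.zero_mulVec]

/-- With `β = G₀⁻¹ C₀`, one has `G_t⁻¹ C_t = β + G_t⁻¹ (C_t - G_t β)` near 0. The bracket vanishes
at 0, so only continuity of the inverse is used, not its derivative. -/
theorem hasDerivAt_matrix_inv_mulVec {G : ℝ → Matrix (Fin k) (Fin k) ℝ} {C : ℝ → Fin k → ℝ}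
    {G' : Matrix (Fin k) (Fin k) ℝ} {C' : Fin k → ℝ}
    (hG : ∀ i j, HasDerivAt (fun t => G t i j) (G' i j) 0)
    (hC : ∀ j, HasDerivAt (fun t => C t j) (C' j) 0) (hdet : (G 0).det ≠ 0) (i : Fin k) :
    HasDerivAt (fun t => ((G t)⁻¹ *ᵥ C t) i)
      (((G 0)⁻¹ *ᵥ (C' - G' *ᵥ ((G 0)⁻¹ *ᵥ C 0))) i) 0 := by
  set β := (G 0)⁻¹ *ᵥ C 0 with hβ
  have hGc : ContinuousAt G 0 :=
    continuousAt_pi.2 fun i => continuousAt_pi.2 fun j => (hG i j).continuousAt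
  have hdetc : ContinuousAt (fun t => (G t).det) 0 :=
    (Continuous.matrix_det continuous_id).continuousAt.comp hGc
  have hinv : ContinuousAt (fun t => (G t)⁻¹) 0 := by
    simp only [Matrix.inv_def, Ring.inverse_eq_inv']
    exact (hdetc.inv₀ hdet).smul ((Continuous.matrix_adjugate continuous_id).continuousAt.comp hGc)
  set e : ℝ → Fin k → ℝ := fun t => C t - G t *ᵥ β with he
  have he0 : e 0 = 0 := by
    rw [he, hβ]
    simp only
    rw [Matrix.mulVec_mulVec, Matrix.mul_nonsing_inv _ (isUnit_iff_ne_zero.2 hdet),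
      Matrix.one_mulVec, sub_self]
  have hed : ∀ j, HasDerivAt (fun t => e t j) ((C' - G' *ᵥ β) j) 0 := fun j => by
    simp only [he, Pi.sub_apply, Matrix.mulVec, dotProduct]
    exact (hC j).sub (HasDerivAt.fun_sum fun l _ => (hG j l).mul_const (β l))
  have key : HasDerivAt (fun t => β i + ∑ j, (G t)⁻¹ i j * e t j)
      (∑ j, (G 0)⁻¹ i j * (C' - G' *ᵥ β) j) 0 :=
    (HasDerivAt.fun_sum fun j _ => hasDerivAt_mul_of_continuousAt
      (continuousAt_pi.1 (continuousAt_pi.1 hinv i) j) (hed j) (congrFun he0 j)).const_add _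
  refine key.congr_of_eventuallyEq ?_
  filter_upwards [hdetc.eventually_ne hdet] with t ht
  change _ = β i + ((G t)⁻¹ *ᵥ e t) i
  rw [← Pi.add_apply, he]
  simp only
  rw [Matrix.mulVec_sub, Matrix.mulVec_mulVec,
    Matrix.nonsing_inv_mul _ (isUnit_iff_ne_zero.2 ht), Matrix.one_mulVec, add_sub_cancel]

theorem hasDerivAt_inv_mul_dotProduct {N : ℝ → ℝ} {A b : ℝ → Fin k → ℝ} {N' : ℝ}
    {A' b' : Fin k → ℝ} (hN : HasDerivAt N N' 0) (hN0 : N 0 ≠ 0)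
    (hA : ∀ j, HasDerivAt (fun t => A t j) (A' j) 0)
    (hb : ∀ j, HasDerivAt (fun t => b t j) (b' j) 0) :
    HasDerivAt (fun t => (N t)⁻¹ * (A t ⬝ᵥ b t))
      ((N 0)⁻¹ * (A' ⬝ᵥ b 0 + A 0 ⬝ᵥ b' - (N 0)⁻¹ * (A 0 ⬝ᵥ b 0) * N')) 0 := by
  have h1 : HasDerivAt (fun t => A t ⬝ᵥ b t) (∑ j, (A' j * b 0 j + A 0 j * b' j)) 0 :=
    HasDerivAt.fun_sum fun j _ => (hA j).mul (hb j)
  refine ((hN.fun_inv hN0).mul h1).congr_deriv ?_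
  rw [Finset.sum_add_distrib]
  change _ * (A 0 ⬝ᵥ b 0) + (N 0)⁻¹ * (A' ⬝ᵥ b 0 + A 0 ⬝ᵥ b') = _
  field_simp
  ring

/-- The conditions under which the estimand is identified and its moments exist. -/
structure Identified (ψ : ℝ → Fin k → ℝ) (P : Measure (Record 𝒳)) : Prop extends Overlap P where
  contDiff : ContDiff ℝ 1 ψ
  integrable_outcome : Integrable (fun w : Record 𝒳 => w.2.2) P
  integrable_feat : ∀ j, Integrable (fun w => feat ψ P w.2.1 j) (obsLaw P)
  integrable_gram : ∀ i j, Integrable (fun w => feat ψ P w.2.1 i * feat ψ P w.2.1 j) (rctLaw P)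
  integrable_cross : ∀ j, Integrable (fun w => w.2.2 * feat ψ P w.2.1 j) (rctLaw P)
  linearIndependent : ∀ c : Fin k → ℝ, c ≠ 0 → rctLaw P {w | c ⬝ᵥ feat ψ P w.2.1 = 0} < 1

theorem gram_symm (ψ : ℝ → Fin k → ℝ) (P : Measure (Record 𝒳)) : (gram ψ P)ᵀ = gram ψ P := by
  ext i j
  simp only [gram, Matrix.transpose_apply, Matrix.of_apply, mul_comm]

theorem measurable_feat {ψ : ℝ → Fin k → ℝ} (hψ : ContDiff ℝ 1 ψ) (P : Measure (Record 𝒳)) :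
    Measurable (feat ψ P) :=
  hψ.continuous.measurable.comp (measurable_contrast P)

namespace Identified

variable {ψ : ℝ → Fin k → ℝ} {P : Measure (Record 𝒳)} [IsProbabilityMeasure P]

/-- A kernel vector `c` gives `E[(cᵀψ(Δ(X)))² | Q = 2] = cᵀ G c = 0`, hence `cᵀψ(Δ(X)) = 0` almost
surely, against linear independence. -/
theorem gram_det_ne_zero (h : Identified ψ P) : (gram ψ P).det ≠ 0 := by
  intro hdet
  obtain ⟨c, hc, hGc⟩ := Matrix.exists_mulVec_eq_zero_iff.2 hdet
  have := h.toOverlap.isProbabilityMeasure_rctLaw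
  have e : ∀ w : Record 𝒳, (c ⬝ᵥ feat ψ P w.2.1) ^ 2
      = ∑ i, ∑ j, c i * c j * (feat ψ P w.2.1 i * feat ψ P w.2.1 j) := fun w => by
    rw [sq, dotProduct, Finset.sum_mul_sum]
    exact Finset.sum_congr rfl fun i _ => Finset.sum_congr rfl fun j _ => by ring
  have hint : ∀ i j, Integrable
      (fun w => c i * c j * (feat ψ P w.2.1 i * feat ψ P w.2.1 j)) (rctLaw P) := fun i j =>
    (h.integrable_gram i j).const_mul _
  have hi2 : Integrable (fun w => (c ⬝ᵥ feat ψ P w.2.1) ^ 2) (rctLaw P) := by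
    simp only [e]
    exact integrable_finsetSum _ fun i _ => integrable_finsetSum _ fun j _ => hint i j
  have h0 : ∫ w, (c ⬝ᵥ feat ψ P w.2.1) ^ 2 ∂(rctLaw P) = 0 := by
    simp only [e]
    rw [integral_finsetSum _ fun i _ => integrable_finsetSum _ fun j _ => hint i j]
    have : c ⬝ᵥ (gram ψ P *ᵥ c) = 0 := by rw [hGc, dotProduct_zero]
    rw [← this, dotProduct]
    refine Finset.sum_congr rfl fun i _ => ?_
    rw [integral_finsetSum _ fun j _ => hint i j, Matrix.mulVec, dotProduct, Finset.mul_sum]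
    refine Finset.sum_congr rfl fun j _ => ?_
    rw [integral_const_mul, gram, Matrix.of_apply]
    ring
  have hae := (integral_eq_zero_iff_of_nonneg (fun w => sq_nonneg _) hi2).1 h0
  refine (h.linearIndependent c hc).ne ?_
  rw [← measure_univ (μ := rctLaw P)]
  refine measure_congr ?_
  filter_upwards [hae] with w hw
  have hw0 : c ⬝ᵥ feat ψ P w.2.1 = 0 := by simpa using hw
  exact propext ⟨fun _ => trivial, fun _ => hw0⟩

theorem gram_mulVec_betaBar (h : Identified ψ P) :
    gram ψ P *ᵥ betaBar ψ P = crossMoment ψ P := by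
  rw [betaBar, Matrix.mulVec_mulVec,
    Matrix.mul_nonsing_inv _ (isUnit_iff_ne_zero.2 h.gram_det_ne_zero), Matrix.one_mulVec]

end Identified

/-! ### The derivative of the estimand as an integral -/

/-- The derivative of `ᾱᵀ(m ψ(t) - ψ(t) ψ(t)ᵀ β̄)` at `t = Δ(x)`. -/
def projectionDeriv (ψ : ℝ → Fin k → ℝ) (P : Measure (Record 𝒳)) (m : ℝ) (x : 𝒳) : ℝ :=
  alphaBar ψ P ⬝ᵥ (m • deriv ψ (contrast P x)
    - (vecMulVec (feat ψ P x) (deriv ψ (contrast P x))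
        + vecMulVec (deriv ψ (contrast P x)) (feat ψ P x)) *ᵥ betaBar ψ P)

/-- The integrand of the derivative of the estimand along a submodel with score `s`. -/
def gradientIntegrand (ψ : ℝ → Fin k → ℝ) (P : Measure (Record 𝒳)) (s : Record 𝒳 → ℝ)
    (w : Record 𝒳) : ℝ :=
  (if w.1 ≠ 2 then
      1 / (1 - rho P 2) * ((muBar ψ P w.2.1 - tauBar ψ P) * s w
        + deriv ψ (contrast P w.2.1) ⬝ᵥ betaBar ψ P * contrastDeriv P s w.2.1)
    else 0)
  + (if w.1 = 2 then
      1 / rho P 2 * ((w.2.2 - muBar ψ P w.2.1) * (alphaBar ψ P ⬝ᵥ feat ψ P w.2.1) * s w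
        + projectionDeriv ψ P w.2.2 w.2.1 * contrastDeriv P s w.2.1)
    else 0)

/-- The product rule for `aᵀ(y f - f fᵀ b) p`, with `d` the derivative of the contrast and `s` that
of the density at `p = 1`. It matches the experimental part of `gradientIntegrand` with the
differentiated moments `C` and `G`. -/
theorem projection_product_rule (a b f f' : Fin k → ℝ) (y s d : ℝ) :
    (y - f ⬝ᵥ b) * (a ⬝ᵥ f) * s
        + a ⬝ᵥ (y • f' - (vecMulVec f f' + vecMulVec f' f) *ᵥ b) * d
      = ∑ i, a i * (y * (f i * s + f' i * d)
          - ∑ j, (f i * f j * s + (f' i * f j + f i * f' j) * d) * b j) := by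
  have h1 : ∀ i, ∑ j, (f i * f j * s + (f' i * f j + f i * f' j) * d) * b j
      = (f i * s + f' i * d) * (f ⬝ᵥ b) + f i * d * (f' ⬝ᵥ b) := fun i => by
    simp only [dotProduct, Finset.mul_sum, ← Finset.sum_add_distrib]
    exact Finset.sum_congr rfl fun j _ => by ring
  have h2 : ∀ i, (y • f' - (vecMulVec f f' + vecMulVec f' f) *ᵥ b) i
      = y * f' i - (f i * (f' ⬝ᵥ b) + f' i * (f ⬝ᵥ b)) := fun i => by
    simp only [Pi.sub_apply, Pi.smul_apply, smul_eq_mul, Matrix.mulVec, dotProduct,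
      Matrix.add_apply, vecMulVec_apply, Finset.mul_sum, ← Finset.sum_add_distrib]
    congr 1
    exact Finset.sum_congr rfl fun j _ => by ring
  simp only [h1]
  rw [show a ⬝ᵥ f = ∑ i, a i * f i from rfl,
    show a ⬝ᵥ (y • f' - (vecMulVec f f' + vecMulVec f' f) *ᵥ b)
      = ∑ i, a i * (y • f' - (vecMulVec f f' + vecMulVec f' f) *ᵥ b) i from rfl,
    Finset.mul_sum, Finset.sum_mul, Finset.sum_mul, ← Finset.sum_add_distrib]
  refine Finset.sum_congr rfl fun i _ => ?_
  rw [h2]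
  ring

theorem integral_linear_combination {Ω : Type*} [MeasurableSpace Ω] {μ : Measure Ω}
    {n : Ω → ℝ} {A C : Fin k → Ω → ℝ} {G : Fin k → Fin k → Ω → ℝ} (hn : Integrable n μ)
    (hA : ∀ j, Integrable (A j) μ) (hC : ∀ j, Integrable (C j) μ)
    (hG : ∀ i j, Integrable (G i j) μ) (a b t : ℝ) (α β : Fin k → ℝ) :
    Integrable (fun w => a * ∑ j, A j w * β j + b * ∑ i, α i * (C i w - ∑ j, G i j w * β j)
      - a * (t * n w)) μ ∧
    ∫ w, (a * ∑ j, A j w * β j + b * ∑ i, α i * (C i w - ∑ j, G i j w * β j)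
      - a * (t * n w)) ∂μ
      = a * ((fun j => ∫ w, A j w ∂μ) ⬝ᵥ β)
        + b * (α ⬝ᵥ ((fun i => ∫ w, C i w ∂μ)
            - (Matrix.of fun i j => ∫ w, G i j w ∂μ) *ᵥ β))
        - a * (t * ∫ w, n w ∂μ) := by
  have i1 : Integrable (fun w => a * ∑ j, A j w * β j) μ :=
    (integrable_finsetSum _ fun j _ => (hA j).mul_const (β j)).const_mul a
  have i2 : ∀ i, Integrable (fun w => ∑ j, G i j w * β j) μ := fun i =>
    integrable_finsetSum _ fun j _ => (hG i j).mul_const (β j)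
  have i3 : ∀ i, Integrable (fun w => α i * (C i w - ∑ j, G i j w * β j)) μ := fun i =>
    ((hC i).sub (i2 i)).const_mul (α i)
  have i4 : Integrable (fun w => b * ∑ i, α i * (C i w - ∑ j, G i j w * β j)) μ :=
    (integrable_finsetSum _ fun i _ => i3 i).const_mul b
  have i5 : Integrable (fun w => a * (t * n w)) μ := (hn.const_mul t).const_mul a
  have i6 : Integrable (fun w => a * ∑ j, A j w * β j
      + b * ∑ i, α i * (C i w - ∑ j, G i j w * β j)) μ := i1.add i4
  refine ⟨i6.sub i5, ?_⟩
  rw [integral_sub i6 i5, integral_add i1 i4, integral_const_mul, integral_const_mul,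
    integral_const_mul, integral_const_mul, integral_finsetSum _ fun j _ => (hA j).mul_const _,
    integral_finsetSum _ fun i _ => i3 i]
  congr 3
  · exact Finset.sum_congr rfl fun j _ => integral_mul_const _ _
  · refine Finset.sum_congr rfl fun i _ => ?_
    rw [integral_const_mul, integral_sub (hC i) (i2 i),
      integral_finsetSum _ fun j _ => (hG i j).mul_const _]
    congr 2
    exact Finset.sum_congr rfl fun j _ => integral_mul_const _ _

/-! ### Arm indicators and unnormalised moments -/

def obsInd (w : Record 𝒳) : ℝ := if w.1 ≠ 2 then 1 else 0

def rctInd (w : Record 𝒳) : ℝ := if w.1 = 2 then 1 else 0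

theorem measurable_obsInd : Measurable (obsInd : Record 𝒳 → ℝ) :=
  Measurable.ite measurableSet_obs measurable_const measurable_const

theorem measurable_rctInd : Measurable (rctInd : Record 𝒳 → ℝ) :=
  Measurable.ite (measurableSet_arm 2) measurable_const measurable_const

theorem obsInd_mul {𝒳 : Type*} (f : Record 𝒳 → ℝ) :
    (fun w => obsInd w * f w) = {w : Record 𝒳 | w.1 ≠ 2}.indicator f := by
  ext w
  by_cases h : w.1 = 2 <;> simp [obsInd, h]

theorem rctInd_mul {𝒳 : Type*} (f : Record 𝒳 → ℝ) :
    (fun w => rctInd w * f w) = {w : Record 𝒳 | w.1 = 2}.indicator f := by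
  ext w
  by_cases h : w.1 = 2 <;> simp [rctInd, h]

theorem integral_obsInd_mul (P : Measure (Record 𝒳)) (f : Record 𝒳 → ℝ) :
    ∫ w, obsInd w * f w ∂P = ∫ w in {w | w.1 ≠ 2}, f w ∂P := by
  rw [obsInd_mul, integral_indicator measurableSet_obs]

theorem integral_rctInd_mul (P : Measure (Record 𝒳)) (f : Record 𝒳 → ℝ) :
    ∫ w, rctInd w * f w ∂P = ∫ w in {w | w.1 = 2}, f w ∂P := by
  rw [rctInd_mul, integral_indicator (measurableSet_arm 2)]

theorem Overlap.integrable_obsInd_mul {P : Measure (Record 𝒳)} [IsFiniteMeasure P]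
    (h : Overlap P) {f : Record 𝒳 → ℝ} (hf : Integrable f (obsLaw P)) :
    Integrable (fun w => obsInd w * f w) P := by
  rw [obsInd_mul, integrable_indicator_iff measurableSet_obs]
  exact (integrable_cond_iff h.obs_ne_zero).1 hf

theorem Overlap.integrable_rctInd_mul {P : Measure (Record 𝒳)} [IsFiniteMeasure P]
    (h : Overlap P) {f : Record 𝒳 → ℝ} (hf : Integrable f (rctLaw P)) :
    Integrable (fun w => rctInd w * f w) P := by
  rw [rctInd_mul, integrable_indicator_iff (measurableSet_arm 2)]
  exact (integrable_cond_iff (h.arm_ne_zero 2)).1 hf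

theorem integral_obsLaw (P : Measure (Record 𝒳)) [IsProbabilityMeasure P] (f : Record 𝒳 → ℝ) :
    ∫ w, f w ∂(obsLaw P) = (1 - rho P 2)⁻¹ * ∫ w, obsInd w * f w ∂P := by
  rw [obsLaw, integral_cond, real_obs, integral_obsInd_mul]

theorem integral_rctLaw (P : Measure (Record 𝒳)) (f : Record 𝒳 → ℝ) :
    ∫ w, f w ∂(rctLaw P) = (rho P 2)⁻¹ * ∫ w, rctInd w * f w ∂P := by
  rw [rctLaw, integral_cond, integral_rctInd_mul]
  rfl

namespace SmoothSubmodel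

variable {ψ : ℝ → Fin k → ℝ} {P : Measure (Record 𝒳)} (M : SmoothSubmodel ψ P)

/-- The observational mass along a submodel. -/
def obsMass (θ : ℝ) : ℝ := ∫ w, obsInd w * 1 * M.p θ w ∂P

/-- The unnormalised counterparts of `obsMoment`, `gram` and `crossMoment` along a submodel. -/
def obsInt (θ : ℝ) (j : Fin k) : ℝ :=
  ∫ w, obsInd w * ψ (contrast (tilt P M.p θ) w.2.1) j * M.p θ w ∂P

def gramInt (θ : ℝ) : Matrix (Fin k) (Fin k) ℝ := Matrix.of fun i j =>
  ∫ w, rctInd w * (ψ (contrast (tilt P M.p θ) w.2.1) i * ψ (contrast (tilt P M.p θ) w.2.1) j)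
    * M.p θ w ∂P

def crossInt (θ : ℝ) (j : Fin k) : ℝ :=
  ∫ w, rctInd w * w.2.2 * ψ (contrast (tilt P M.p θ) w.2.1) j * M.p θ w ∂P

/-- The mass of the experimental arm cancels between `gram` and `crossMoment`; the observational
mass is the only normaliser left to differentiate. -/
theorem tau_eq (h : Overlap P) {θ : ℝ} (hθ : |θ| < M.ε) :
    obsMoment ψ (tilt P M.p θ) = (M.obsMass θ)⁻¹ • M.obsInt θ ∧
    gram ψ (tilt P M.p θ) = (rho (tilt P M.p θ) 2)⁻¹ • M.gramInt θ ∧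
    betaBar ψ (tilt P M.p θ) = (M.gramInt θ)⁻¹ *ᵥ M.crossInt θ ∧
    M.tau θ = (M.obsMass θ)⁻¹ * (M.obsInt θ ⬝ᵥ ((M.gramInt θ)⁻¹ *ᵥ M.crossInt θ)) := by
  have hm := M.measurable_p θ
  have hpos := M.p_pos θ hθ
  have := M.isProb θ hθ
  have hmass : (tilt P M.p θ).real {w | w.1 ≠ 2} = M.obsMass θ := by
    have := setIntegral_tilt hm hpos measurableSet_obs (fun _ => (1 : ℝ))
    rw [setIntegral_const, smul_eq_mul, mul_one] at this
    rw [this, ← integral_obsInd_mul, obsMass]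
    simp only [mul_one, one_mul]
  have hρ : (rho (tilt P M.p θ) 2)⁻¹ ≠ 0 := inv_ne_zero
    (ENNReal.toReal_pos (tilt_ne_zero hm hpos (h.arm_ne_zero 2)) (measure_ne_top _ _)).ne'
  have h1 : obsMoment ψ (tilt P M.p θ) = (M.obsMass θ)⁻¹ • M.obsInt θ := by
    ext j
    rw [obsMoment, obsLaw, integral_cond, setIntegral_tilt hm hpos measurableSet_obs, hmass,
      ← integral_obsInd_mul]
    simp only [Pi.smul_apply, smul_eq_mul, obsInt, feat, mul_assoc]
  have h2 : gram ψ (tilt P M.p θ) = (rho (tilt P M.p θ) 2)⁻¹ • M.gramInt θ := by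
    ext i j
    rw [gram, Matrix.of_apply, rctLaw, integral_cond,
      setIntegral_tilt hm hpos (measurableSet_arm 2), ← integral_rctInd_mul]
    simp only [Matrix.smul_apply, smul_eq_mul, gramInt, feat, mul_assoc, rho, Matrix.of_apply]
  have h3 : crossMoment ψ (tilt P M.p θ) = (rho (tilt P M.p θ) 2)⁻¹ • M.crossInt θ := by
    ext j
    rw [crossMoment, rctLaw, integral_cond,
      setIntegral_tilt hm hpos (measurableSet_arm 2), ← integral_rctInd_mul]
    simp only [Pi.smul_apply, smul_eq_mul, crossInt, feat, mul_assoc, rho]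
  have h4 : betaBar ψ (tilt P M.p θ) = (M.gramInt θ)⁻¹ *ᵥ M.crossInt θ := by
    rw [betaBar, h2, h3, inv_smul_mulVec_smul hρ]
  refine ⟨h1, h2, h4, ?_⟩
  rw [tau, tauBar, h1, h4, smul_dotProduct, smul_eq_mul]

variable [IsProbabilityMeasure P]

theorem hasDerivAt_obsMass (h : Identified ψ P) :
    Integrable (fun w => obsInd w * M.score w) P ∧
      HasDerivAt M.obsMass (∫ w, obsInd w * M.score w ∂P) 0 := by
  obtain ⟨B, hB, hb⟩ := M.dom_mass
  have := h.isProbabilityMeasure_obsLaw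
  have := M.hasDerivAt_moment h.toOverlap h.integrable_outcome measurable_obsInd
    (f := fun _ => 1) (f' := fun _ => 0) (fun t => hasDerivAt_const t 1)
    (by simpa using h.integrable_obsInd_mul (integrable_const (μ := obsLaw P) (1 : ℝ)))
    ⟨B, hB, fun θ hθ => by
      filter_upwards [hb θ hθ] with w hw
      by_cases hq : w.1 = 2
      · simpa [obsInd, hq] using (abs_nonneg _).trans hw
      · simpa [obsInd, hq] using hw⟩
  simp only [one_mul, zero_mul, add_zero] at this
  exact this

theorem hasDerivAt_obsInt (h : Identified ψ P) (j : Fin k) :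
    Integrable (fun w => obsInd w * (feat ψ P w.2.1 j * M.score w
        + deriv ψ (contrast P w.2.1) j * contrastDeriv P M.score w.2.1)) P ∧
      HasDerivAt (fun θ => M.obsInt θ j) (∫ w, obsInd w * (feat ψ P w.2.1 j * M.score w
        + deriv ψ (contrast P w.2.1) j * contrastDeriv P M.score w.2.1) ∂P) 0 := by
  refine M.hasDerivAt_moment h.toOverlap h.integrable_outcome measurable_obsInd
    (f := fun t => ψ t j) (f' := fun t => deriv ψ t j) (fun t => hasDerivAt_pi.1
      ((h.contDiff.differentiable one_ne_zero) t).hasDerivAt j)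
    (h.integrable_obsInd_mul (h.integrable_feat j)) ?_
  convert M.dom_obsMoment j using 3 with θ w
  by_cases hq : w.1 = 2 <;> simp [obsInd, hq, feat]

theorem hasDerivAt_gramInt (h : Identified ψ P) (i j : Fin k) :
    Integrable (fun w => rctInd w * (feat ψ P w.2.1 i * feat ψ P w.2.1 j * M.score w
        + (deriv ψ (contrast P w.2.1) i * feat ψ P w.2.1 j
          + feat ψ P w.2.1 i * deriv ψ (contrast P w.2.1) j)
          * contrastDeriv P M.score w.2.1)) P ∧
      HasDerivAt (fun θ => M.gramInt θ i j)
        (∫ w, rctInd w * (feat ψ P w.2.1 i * feat ψ P w.2.1 j * M.score w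
          + (deriv ψ (contrast P w.2.1) i * feat ψ P w.2.1 j
            + feat ψ P w.2.1 i * deriv ψ (contrast P w.2.1) j)
            * contrastDeriv P M.score w.2.1) ∂P) 0 := by
  have hd : ∀ t j, HasDerivAt (fun t => ψ t j) (deriv ψ t j) t := fun t j => hasDerivAt_pi.1
      ((h.contDiff.differentiable one_ne_zero) t).hasDerivAt j
  refine M.hasDerivAt_moment h.toOverlap h.integrable_outcome measurable_rctInd
    (f := fun t => ψ t i * ψ t j) (f' := fun t => deriv ψ t i * ψ t j + ψ t i * deriv ψ t j)
    (fun t => (hd t i).mul (hd t j))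
    (h.integrable_rctInd_mul (h.integrable_gram i j)) ?_
  convert M.dom_gram i j using 3 with θ w
  by_cases hq : w.1 = 2 <;> simp [rctInd, hq, feat]

theorem hasDerivAt_crossInt (h : Identified ψ P) (j : Fin k) :
    Integrable (fun w => rctInd w * w.2.2 * (feat ψ P w.2.1 j * M.score w
        + deriv ψ (contrast P w.2.1) j * contrastDeriv P M.score w.2.1)) P ∧
      HasDerivAt (fun θ => M.crossInt θ j)
        (∫ w, rctInd w * w.2.2 * (feat ψ P w.2.1 j * M.score w
          + deriv ψ (contrast P w.2.1) j * contrastDeriv P M.score w.2.1) ∂P) 0 := by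
  refine M.hasDerivAt_moment h.toOverlap h.integrable_outcome
    (g := fun w => rctInd w * w.2.2) (measurable_rctInd.mul measurable_snd.snd)
    (f := fun t => ψ t j) (f' := fun t => deriv ψ t j) (fun t => hasDerivAt_pi.1
      ((h.contDiff.differentiable one_ne_zero) t).hasDerivAt j)
    ((h.integrable_rctInd_mul (h.integrable_cross j)).congr (by simp [mul_assoc, feat])) ?_
  convert M.dom_crossMoment j using 3 with θ w
  by_cases hq : w.1 = 2 <;> simp [rctInd, hq, feat]

theorem hasDerivAt_tau (h : Identified ψ P) :
    Integrable (gradientIntegrand ψ P M.score) P ∧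
      HasDerivAt M.tau (∫ w, gradientIntegrand ψ P M.score w ∂P) 0 := by
  obtain ⟨n1, n2⟩ := M.hasDerivAt_obsMass h
  have a1 := fun j => (M.hasDerivAt_obsInt h j).1
  have a2 := fun j => (M.hasDerivAt_obsInt h j).2
  have g1 := fun i j => (M.hasDerivAt_gramInt h i j).1
  have g2 := fun i j => (M.hasDerivAt_gramInt h i j).2
  have c1 := fun j => (M.hasDerivAt_crossInt h j).1
  have c2 := fun j => (M.hasDerivAt_crossInt h j).2
  obtain ⟨e1, e2, e3, e4⟩ := M.tau_eq h.toOverlap (θ := 0) (by simpa using M.ε_pos)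
  rw [M.tilt_zero_eq] at e1 e2 e3
  have hρ := (h.rho_pos 2).ne'
  have hN0 : M.obsMass 0 = 1 - rho P 2 := by
    have : M.obsMass 0 = ∫ w, obsInd w * 1 ∂P := by
      refine integral_congr_ae ?_
      filter_upwards [M.p_zero] with w hw
      rw [hw, mul_one]
    rw [this, integral_obsInd_mul, setIntegral_const, smul_eq_mul, mul_one, real_obs]
  have hG0 : M.gramInt 0 = rho P 2 • gram ψ P := by
    rw [e2, smul_smul, mul_inv_cancel₀ hρ, one_smul]
  have hdet : (M.gramInt 0).det ≠ 0 := by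
    rw [hG0, Matrix.det_smul]
    exact mul_ne_zero (pow_ne_zero _ hρ) h.gram_det_ne_zero
  -- By symmetry of the Gram matrix its inverse can be moved onto the observational moment, which is
  -- how `ᾱ` enters the gradient.
  have hα : ∀ v : Fin k → ℝ, (1 - rho P 2)⁻¹ * (M.obsInt 0 ⬝ᵥ ((M.gramInt 0)⁻¹ *ᵥ v))
      = (rho P 2)⁻¹ * (alphaBar ψ P ⬝ᵥ v) := fun v => by
    have hv : (M.gramInt 0)⁻¹ *ᵥ v = (rho P 2)⁻¹ • ((gram ψ P)⁻¹ *ᵥ v) := by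
      rw [hG0, ← inv_smul_mulVec_smul hρ (gram ψ P) v, Matrix.mulVec_smul, smul_smul,
        inv_mul_cancel₀ hρ, one_smul]
    rw [hv, dotProduct_smul, smul_eq_mul, ← mul_assoc, mul_comm _ (rho P 2)⁻¹, mul_assoc,
      ← smul_eq_mul (1 - rho P 2)⁻¹, ← smul_dotProduct, ← hN0, ← e1, alphaBar,
      dotProduct_mulVec, ← Matrix.mulVec_transpose, Matrix.transpose_nonsing_inv, gram_symm]
  have hA := hasDerivAt_inv_mul_dotProduct n2 (by rw [hN0]; exact h.one_sub_rho_pos.ne') a2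
    fun j => hasDerivAt_matrix_inv_mulVec
      (G' := Matrix.of fun i j => ∫ w, rctInd w * (feat ψ P w.2.1 i * feat ψ P w.2.1 j * M.score w
        + (deriv ψ (contrast P w.2.1) i * feat ψ P w.2.1 j
          + feat ψ P w.2.1 i * deriv ψ (contrast P w.2.1) j)
          * contrastDeriv P M.score w.2.1) ∂P) g2 c2 hdet j
  have hτ : (1 - rho P 2)⁻¹ * (M.obsInt 0 ⬝ᵥ betaBar ψ P) = tauBar ψ P := by
    rw [tauBar, e1, hN0, smul_dotProduct, smul_eq_mul]
  rw [hN0, ← e3, hτ, mul_sub, mul_add, hα] at hA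
  have hev : M.tau =ᶠ[𝓝 0] fun t =>
      (M.obsMass t)⁻¹ * (M.obsInt t ⬝ᵥ ((M.gramInt t)⁻¹ *ᵥ M.crossInt t)) := by
    have : ∀ᶠ t : ℝ in 𝓝 0, |t| < M.ε := by
      have := continuous_abs.tendsto (0 : ℝ)
      rw [abs_zero] at this
      exact this.eventually (gt_mem_nhds M.ε_pos)
    filter_upwards [this] with t ht using (M.tau_eq h.toOverlap ht).2.2.2
  -- The last term, with `τ̄`, is the derivative of the normaliser `N⁻¹`; it centres `μ̄` in the
  -- observational part.
  have hpt : gradientIntegrand ψ P M.score = fun w =>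
      ((1 - rho P 2)⁻¹ * ∑ j, (obsInd w * (feat ψ P w.2.1 j * M.score w
        + deriv ψ (contrast P w.2.1) j * contrastDeriv P M.score w.2.1)) * betaBar ψ P j
      + (rho P 2)⁻¹ * ∑ i, alphaBar ψ P i * (rctInd w * w.2.2 * (feat ψ P w.2.1 i * M.score w
          + deriv ψ (contrast P w.2.1) i * contrastDeriv P M.score w.2.1)
        - ∑ j, (rctInd w * (feat ψ P w.2.1 i * feat ψ P w.2.1 j * M.score w
          + (deriv ψ (contrast P w.2.1) i * feat ψ P w.2.1 j
            + feat ψ P w.2.1 i * deriv ψ (contrast P w.2.1) j)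
            * contrastDeriv P M.score w.2.1)) * betaBar ψ P j))
      - (1 - rho P 2)⁻¹ * (tauBar ψ P * (obsInd w * M.score w)) := by
    ext w
    by_cases hq : w.1 = 2
    · simp only [gradientIntegrand, hq, ne_eq, not_true_eq_false, if_false, if_true, obsInd, rctInd,
        zero_mul, Finset.sum_const_zero, mul_zero, zero_add, sub_zero, one_mul, one_div]
      rw [projectionDeriv, muBar, projection_product_rule]
    · simp only [gradientIntegrand, hq, ne_eq, not_false_eq_true, if_false, if_true, obsInd, rctInd,
        zero_mul, Finset.sum_const_zero, mul_zero, add_zero, sub_zero, one_mul, one_div]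
      rw [← mul_sub]
      congr 1
      simp only [muBar, dotProduct, add_mul, Finset.sum_add_distrib, sub_mul, Finset.sum_mul]
      rw [add_sub_right_comm]
      congr 1
      · congr 1
        refine Finset.sum_congr rfl fun i _ => ?_
        ring
      · refine Finset.sum_congr rfl fun i _ => ?_
        ring
  obtain ⟨i1, i2⟩ := integral_linear_combination n1 a1 c1 g1 (1 - rho P 2)⁻¹ (rho P 2)⁻¹
    (tauBar ψ P) (alphaBar ψ P) (betaBar ψ P)
  refine ⟨hpt ▸ i1, (hA.congr_of_eventuallyEq hev).congr_deriv ?_⟩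
  rw [hpt, i2]

end SmoothSubmodel

/-! ### The candidate influence function represents the derivative -/

/-- The experimental covariate law is only dominated by the observational one, so `Λ` may vanish on
a set of positive `obsX P`-measure. Kernel statements of arm 2 are therefore available only where
its weight is nonzero. -/
theorem Overlap.ae_obsX_of_ae_fst {P : Measure (Record 𝒳)} [IsProbabilityMeasure P]
    (h : Overlap P) {q : Fin 3} {p : 𝒳 → Prop} (hp : ∀ᵐ x ∂(lawXY P q).fst, p x) :
    ∀ᵐ x ∂(obsX P), armWeight P q x ≠ 0 → p x := by
  have h1 : ∀ᵐ x ∂(armX P q), p x := by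
    rw [← smul_fst_lawXY]
    exact Measure.smul_absolutelyContinuous hp
  rw [h.armX_eq, ae_withDensity_iff (measurable_armWeight P q).ennreal_ofReal] at h1
  filter_upwards [h1, h.armWeight_nonneg q] with x hx hx0 hne
  exact hx (by simpa using lt_of_le_of_ne hx0 hne.symm)

theorem kappa_eq (ψ : ℝ → Fin k → ℝ) (P : Measure (Record 𝒳)) (x : 𝒳) :
    kappa ψ P x = deriv ψ (contrast P x) ⬝ᵥ betaBar ψ P
      + likRatio P x * projectionDeriv ψ P (condMean P 2 x) x := rfl

/-- The expansion is affine in `m`, so averaging over `y` in arm 2 amounts to replacing `y` by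
`m₂(x)`. -/
theorem projectionDeriv_eq (ψ : ℝ → Fin k → ℝ) (P : Measure (Record 𝒳)) (m : ℝ) (x : 𝒳) :
    projectionDeriv ψ P m x = m * (alphaBar ψ P ⬝ᵥ deriv ψ (contrast P x))
      - ((alphaBar ψ P ⬝ᵥ feat ψ P x) * (deriv ψ (contrast P x) ⬝ᵥ betaBar ψ P)
        + (alphaBar ψ P ⬝ᵥ deriv ψ (contrast P x)) * (feat ψ P x ⬝ᵥ betaBar ψ P)) := by
  have h : ∀ u v b : Fin k → ℝ, vecMulVec u v *ᵥ b = (v ⬝ᵥ b) • u := fun u v b => by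
    ext i
    simp only [Matrix.mulVec, dotProduct, vecMulVec_apply, Pi.smul_apply, smul_eq_mul,
      Finset.sum_mul]
    exact Finset.sum_congr rfl fun j _ => by ring
  simp only [projectionDeriv, dotProduct_sub, dotProduct_smul, smul_eq_mul, Matrix.add_mulVec, h,
    dotProduct_add]
  ring

/-! ### Measurability of the candidate influence function -/

theorem measurable_dotProduct {α : Type*} [MeasurableSpace α] {f g : α → Fin k → ℝ}
    (hf : Measurable f) (hg : Measurable g) : Measurable fun a => f a ⬝ᵥ g a :=
  Finset.measurable_fun_sum _ fun i _ => (measurable_pi_iff.1 hf i).mul (measurable_pi_iff.1 hg i)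

theorem measurable_kappa {ψ : ℝ → Fin k → ℝ} (hψ : ContDiff ℝ 1 ψ) (P : Measure (Record 𝒳)) :
    Measurable (kappa ψ P) := by
  have hf := measurable_feat hψ P
  have hd : Measurable fun x => deriv ψ (contrast P x) :=
    (hψ.continuous_deriv le_rfl).measurable.comp (measurable_contrast P)
  have hα : Measurable fun _ : 𝒳 => alphaBar ψ P := measurable_const
  have hβ : Measurable fun _ : 𝒳 => betaBar ψ P := measurable_const
  simp only [funext (kappa_eq ψ P), projectionDeriv_eq]
  exact (measurable_dotProduct hd hβ).add ((measurable_likRatio P).mul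
    (((measurable_condMean P 2).mul (measurable_dotProduct hα hd)).sub
      (((measurable_dotProduct hα hf).mul (measurable_dotProduct hd hβ)).add
        ((measurable_dotProduct hα hd).mul (measurable_dotProduct hf hβ)))))

theorem measurable_iota (P : Measure (Record 𝒳)) : Measurable (iota P) := by
  have hX := measurable_covariate (𝒳 := 𝒳)
  have hr := (measurable_propensity P).comp hX
  have hy : Measurable fun w : Record 𝒳 => w.2.2 := measurable_snd.snd
  exact (Measurable.ite (measurableSet_arm 1) ((hr.const_div 1).mul
      (hy.sub ((measurable_condMean P 1).comp hX))) measurable_const).sub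
    (Measurable.ite (measurableSet_arm 0) (((hr.const_sub 1).const_div 1).mul
      (hy.sub ((measurable_condMean P 0).comp hX))) measurable_const)

theorem measurable_eif {ψ : ℝ → Fin k → ℝ} (hψ : ContDiff ℝ 1 ψ) (P : Measure (Record 𝒳)) :
    Measurable (eif ψ P) := by
  have hX := measurable_covariate (𝒳 := 𝒳)
  have hf := (measurable_feat hψ P).comp hX
  have hμ : Measurable fun w : Record 𝒳 => muBar ψ P w.2.1 :=
    measurable_dotProduct hf measurable_const
  have hα : Measurable fun w : Record 𝒳 => alphaBar ψ P ⬝ᵥ feat ψ P w.2.1 :=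
    measurable_dotProduct measurable_const hf
  have hy : Measurable fun w : Record 𝒳 => w.2.2 := measurable_snd.snd
  exact (Measurable.ite measurableSet_obs (((hμ.sub_const _).add
      ((measurable_iota P).mul ((measurable_kappa hψ P).comp hX))).const_mul _)
        measurable_const).add
    (Measurable.ite (measurableSet_arm 2) (((hy.sub hμ).const_mul _).mul hα) measurable_const)

namespace Identified

variable {ψ : ℝ → Fin k → ℝ} {P : Measure (Record 𝒳)} [IsProbabilityMeasure P]

theorem ae_integrable_condKernel (h : Identified ψ P) (q : Fin 3) :
    ∀ᵐ x ∂(lawXY P q).fst, Integrable (fun y : ℝ => y) ((lawXY P q).condKernel x) :=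
  ((integrable_lawXY_iff (f := fun w => w.2.2) (h.arm_ne_zero q)).2
    h.integrable_outcome.integrableOn).condKernel_ae

/-- The difference of the two integrands is integrated arm by arm over each fibre. The terms with
`(μ̄ - τ̄) s` and `(y - μ̄) ᾱᵀψ s` cancel pointwise, leaving the `ι κ` terms against those with the
derivative of `Δ`. -/
theorem integral_eif_mul_score (h : Identified ψ P) (M : SmoothSubmodel ψ P)
    (hint : Integrable (fun w => eif ψ P w * M.score w) P) :
    ∫ w, eif ψ P w * M.score w ∂P = ∫ w, gradientIntegrand ψ P M.score w ∂P := by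
  have hg := (M.hasDerivAt_tau h).1
  rw [← sub_eq_zero, ← integral_sub hint hg]
  refine h.integral_eq_zero (hint.sub hg) ?_
  have hs := fun q => h.ae_obsX_of_ae_fst ((integrable_lawXY_iff (f := M.score)
    (h.arm_ne_zero q)).2 M.integrable_score.integrableOn).condKernel_ae
  have hys := fun q => h.ae_obsX_of_ae_fst ((integrable_lawXY_iff (h.arm_ne_zero q)).2
    (M.integrable_obs_outcome_mul_score h.integrable_outcome).integrableOn).condKernel_ae
  have hy := h.ae_obsX_of_ae_fst (h.ae_integrable_condKernel 2)
  filter_upwards [hs 0, hs 1, hys 0, hys 1, hy, h.propensity_mem] with x s0 s1 ys0 ys1 y2 hr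
  have hN := h.one_sub_rho_pos
  have hρ := h.rho_pos 2
  have hr1 : 0 < 1 - propensity P x := by linarith [hr.2]
  have w0 : armWeight P 0 x = (1 - rho P 2) * (1 - propensity P x) := rfl
  have w1 : armWeight P 1 x = (1 - rho P 2) * propensity P x := rfl
  have w2 : armWeight P 2 x = rho P 2 * likRatio P x := rfl
  have hw0 : armWeight P 0 x ≠ 0 := by rw [w0]; positivity
  have hw1 : armWeight P 1 x ≠ 0 := by rw [w1]; exact (mul_pos hN hr.1).ne'
  replace s0 := s0 hw0
  replace s1 := s1 hw1
  replace ys0 : Integrable (fun y => y * M.score (0, x, y))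
      ((lawXY P 0).condKernel x) := by simpa using ys0 hw0
  replace ys1 : Integrable (fun y => y * M.score (1, x, y))
      ((lawXY P 1).condKernel x) := by simpa using ys1 hw1
  set d := contrastDeriv P M.score x with hd
  set D := deriv ψ (contrast P x) ⬝ᵥ betaBar ψ P with hD
  have c0 : ∫ y, (eif ψ P (0, x, y) * M.score (0, x, y)
        - gradientIntegrand ψ P M.score (0, x, y)) ∂((lawXY P 0).condKernel x)
      = 1 / (1 - rho P 2) * (-(1 / (1 - propensity P x) * kappa ψ P x
          * condMeanDeriv P M.score 0 x) - D * d) := by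
    have e : ∀ y, eif ψ P (0, x, y) * M.score (0, x, y)
        - gradientIntegrand ψ P M.score (0, x, y)
        = 1 / (1 - rho P 2) * (-(1 / (1 - propensity P x) * kappa ψ P x
          * (y * M.score (0, x, y) - condMean P 0 x * M.score (0, x, y))) - D * d) := fun y => by
      simp [eif, gradientIntegrand, iota, hd, hD]
      ring
    simp only [e]
    rw [integral_const_mul, integral_sub _ (integrable_const _), integral_neg, integral_const_mul,
      integral_sub ys0 (s0.const_mul _), integral_const_mul, integral_const, probReal_univ,
      one_smul]
    · rfl
    · exact ((ys0.sub (s0.const_mul _)).const_mul _).neg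
  have c1 : ∫ y, (eif ψ P (1, x, y) * M.score (1, x, y)
        - gradientIntegrand ψ P M.score (1, x, y)) ∂((lawXY P 1).condKernel x)
      = 1 / (1 - rho P 2) * (1 / propensity P x * kappa ψ P x
          * condMeanDeriv P M.score 1 x - D * d) := by
    have e : ∀ y, eif ψ P (1, x, y) * M.score (1, x, y)
        - gradientIntegrand ψ P M.score (1, x, y)
        = 1 / (1 - rho P 2) * (1 / propensity P x * kappa ψ P x
          * (y * M.score (1, x, y) - condMean P 1 x * M.score (1, x, y)) - D * d) := fun y => by
      simp [eif, gradientIntegrand, iota, hd, hD]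
      ring
    simp only [e]
    rw [integral_const_mul, integral_sub _ (integrable_const _), integral_const_mul,
      integral_sub ys1 (s1.const_mul _), integral_const_mul, integral_const, probReal_univ,
      one_smul]
    · rfl
    · exact (ys1.sub (s1.const_mul _)).const_mul _
  have c2 : armWeight P 2 x * ∫ y, (eif ψ P (2, x, y) * M.score (2, x, y)
        - gradientIntegrand ψ P M.score (2, x, y)) ∂((lawXY P 2).condKernel x)
      = -(likRatio P x * projectionDeriv ψ P (condMean P 2 x) x * d) := by
    -- Where the weight vanishes so does `Λ`, and both sides are zero without integrability of `y`
    -- in the fibre.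
    by_cases hw2 : armWeight P 2 x = 0
    · have : likRatio P x = 0 := (mul_eq_zero.1 (w2 ▸ hw2)).resolve_left hρ.ne'
      rw [hw2, this]
      ring
    · have e : ∀ y, eif ψ P (2, x, y) * M.score (2, x, y)
          - gradientIntegrand ψ P M.score (2, x, y)
          = -(1 / rho P 2 * d) * (y * (alphaBar ψ P ⬝ᵥ deriv ψ (contrast P x))
            + projectionDeriv ψ P 0 x) := fun y => by
        simp only [eif, gradientIntegrand, ne_eq, not_true_eq_false, if_false, if_true, zero_add]
        rw [projectionDeriv_eq ψ P y x, projectionDeriv_eq ψ P 0 x]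
        ring
      simp only [e]
      rw [integral_const_mul, integral_add ((y2 hw2).mul_const _) (integrable_const _),
        integral_mul_const, integral_const, probReal_univ, one_smul, projectionDeriv_eq,
        projectionDeriv_eq,
        show (∫ y, y ∂((lawXY P 2).condKernel x)) = condMean P 2 x from rfl, w2]
      field_simp
      ring
  -- The weights `(1 - ρ₂)(1 - r)` and `(1 - ρ₂) r` cancel the inverse propensities. What remains is
  -- `κ d - D d - Λ · projectionDeriv · d`, which is zero by the definition of `κ`.
  rw [Fin.sum_univ_three, c0, c1, c2, w0, w1, kappa_eq, ← hD]
  have hdd : d = condMeanDeriv P M.score 1 x - condMeanDeriv P M.score 0 x := rfl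
  have hr0 := hr.1.ne'
  rw [hdd]
  field_simp
  ring

/-- The observational term `μ̄ - τ̄` is centred by the definition of `τ̄`, the experimental term by
the normal equations `G β̄ = E[Y ψ | Q = 2]`. The remainder `ι κ` is integrable as a difference of
integrable functions, and its mean given `X` vanishes within each observational arm. -/
theorem integral_eif_eq_zero (h : Identified ψ P) (hint : Integrable (eif ψ P) P) :
    ∫ w, eif ψ P w ∂P = 0 := by
  have hN := h.one_sub_rho_pos
  have hρ := h.rho_pos 2
  have := h.isProbabilityMeasure_obsLaw
  have := h.isProbabilityMeasure_rctLaw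
  have i1 : Integrable (fun w => muBar ψ P w.2.1) (obsLaw P) :=
    integrable_finsetSum Finset.univ fun j _ => (h.integrable_feat j).mul_const (betaBar ψ P j)
  have i2 : ∀ i, Integrable (fun w => ∑ j, feat ψ P w.2.1 i * feat ψ P w.2.1 j * betaBar ψ P j)
      (rctLaw P) := fun i => integrable_finsetSum _ fun j _ => (h.integrable_gram i j).mul_const _
  have i3 : ∀ i, Integrable (fun w => alphaBar ψ P i * (w.2.2 * feat ψ P w.2.1 i
      - ∑ j, feat ψ P w.2.1 i * feat ψ P w.2.1 j * betaBar ψ P j)) (rctLaw P) := fun i =>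
    ((h.integrable_cross i).sub (i2 i)).const_mul _
  have z1 : ∫ w, (muBar ψ P w.2.1 - tauBar ψ P) ∂(obsLaw P) = 0 := by
    rw [integral_sub i1 (integrable_const _), integral_const, probReal_univ, one_smul, sub_eq_zero]
    simp only [muBar, tauBar, dotProduct]
    rw [integral_finsetSum _ fun j _ => (h.integrable_feat j).mul_const _]
    exact Finset.sum_congr rfl fun j _ => integral_mul_const _ _
  have z2 : ∫ w, ∑ i, alphaBar ψ P i * (w.2.2 * feat ψ P w.2.1 i
      - ∑ j, feat ψ P w.2.1 i * feat ψ P w.2.1 j * betaBar ψ P j) ∂(rctLaw P) = 0 := by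
    rw [integral_finsetSum _ fun i _ => i3 i]
    refine Finset.sum_eq_zero fun i _ => ?_
    rw [integral_const_mul, integral_sub (h.integrable_cross i) (i2 i),
      integral_finsetSum _ fun j _ => (h.integrable_gram i j).mul_const _]
    have := congrFun h.gram_mulVec_betaBar i
    simp only [Matrix.mulVec, dotProduct, gram, Matrix.of_apply, crossMoment] at this
    simp only [integral_mul_const]
    rw [this, sub_self, mul_zero]
  set A : Record 𝒳 → ℝ := fun w => 1 / (1 - rho P 2) *
    (obsInd w * (muBar ψ P w.2.1 - tauBar ψ P)) with hA
  set B : Record 𝒳 → ℝ := fun w => 1 / rho P 2 *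
    (rctInd w * ∑ i, alphaBar ψ P i * (w.2.2 * feat ψ P w.2.1 i
      - ∑ j, feat ψ P w.2.1 i * feat ψ P w.2.1 j * betaBar ψ P j)) with hB
  have iA : Integrable A P := (h.integrable_obsInd_mul (i1.sub (integrable_const _))).const_mul _
  have iB : Integrable B P :=
    (h.integrable_rctInd_mul (integrable_finsetSum _ fun i _ => i3 i)).const_mul _
  have zA : ∫ w, A w ∂P = 0 := by
    rw [integral_const_mul, one_div, ← integral_obsLaw, z1]
  have zB : ∫ w, B w ∂P = 0 := by
    rw [integral_const_mul, one_div, ← integral_rctLaw, z2]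
  have iAB : Integrable (fun w => A w + B w) P := iA.add iB
  have key : ∫ w, (eif ψ P w - (A w + B w)) ∂P = 0 := by
    refine h.integral_eq_zero (hint.sub iAB) ?_
    have hy := fun q => h.ae_obsX_of_ae_fst (h.ae_integrable_condKernel q)
    filter_upwards [hy 0, hy 1, h.propensity_mem] with x y0 y1 hr
    have hr1 : 0 < 1 - propensity P x := by linarith [hr.2]
    have hw0 : armWeight P 0 x ≠ 0 := (mul_pos hN hr1).ne'
    have hw1 : armWeight P 1 x ≠ 0 := (mul_pos hN hr.1).ne'
    have c0 : ∫ y, (eif ψ P (0, x, y) - (A (0, x, y) + B (0, x, y)))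
        ∂((lawXY P 0).condKernel x) = 0 := by
      have e : ∀ y, eif ψ P (0, x, y) - (A (0, x, y) + B (0, x, y))
          = -(1 / (1 - rho P 2) * (1 / (1 - propensity P x) * kappa ψ P x))
            * (y - condMean P 0 x) := fun y => by
        simp [eif, hA, hB, iota, obsInd, rctInd]
        ring
      simp only [e]
      rw [integral_const_mul, integral_sub (y0 hw0) (integrable_const _), integral_const,
        probReal_univ, one_smul]
      simp [condMean]
    have c1 : ∫ y, (eif ψ P (1, x, y) - (A (1, x, y) + B (1, x, y)))
        ∂((lawXY P 1).condKernel x) = 0 := by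
      have e : ∀ y, eif ψ P (1, x, y) - (A (1, x, y) + B (1, x, y))
          = 1 / (1 - rho P 2) * (1 / propensity P x * kappa ψ P x)
            * (y - condMean P 1 x) := fun y => by
        simp [eif, hA, hB, iota, obsInd, rctInd]
        ring
      simp only [e]
      rw [integral_const_mul, integral_sub (y1 hw1) (integrable_const _), integral_const,
        probReal_univ, one_smul]
      simp [condMean]
    have c2 : ∀ y, eif ψ P (2, x, y) - (A (2, x, y) + B (2, x, y)) = 0 := fun y => by
      -- Taking `f' = 0`, `s = 1`, `d = 0` leaves only the expansion of `(y - μ̄) ᾱᵀψ` into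
      -- components.
      have := projection_product_rule (alphaBar ψ P) (betaBar ψ P) (feat ψ P x) 0 y 1 0
      simp only [mul_one, mul_zero, add_zero, Pi.zero_apply, zero_mul] at this
      simp only [eif, hA, hB, obsInd, rctInd, ne_eq, not_true_eq_false, if_false, if_true,
        zero_add, zero_mul, mul_zero, one_mul]
      rw [muBar, mul_assoc, this, sub_self]
    rw [Fin.sum_univ_three, c0, c1]
    simp [c2]
  rw [integral_sub hint iAB, integral_add iA iB, zA, zB] at key
  linarith

end Identified

/-! ### Submodels with bounded score -/

/-- The covariate values at which `E[|Y| | X = x, Q = q] ≤ K` for `q = 0, 1`. -/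
def tameSet (P : Measure (Record 𝒳)) (K : ℝ) : Set 𝒳 :=
  {x | ∫ y, |y| ∂((lawXY P 0).condKernel x) ≤ K ∧ ∫ y, |y| ∂((lawXY P 1).condKernel x) ≤ K}

theorem measurableSet_tameSet (P : Measure (Record 𝒳)) (K : ℝ) : MeasurableSet (tameSet P K) := by
  have h : ∀ q, Measurable fun x => ∫ y, |y| ∂((lawXY P q).condKernel x) := fun q =>
    (StronglyMeasurable.integral_kernel (κ := (lawXY P q).condKernel)
      (f := fun y : ℝ => |y|) measurable_id.abs.stronglyMeasurable).measurable
  exact (measurableSet_le (h 0) measurable_const).inter (measurableSet_le (h 1) measurable_const)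

/-- The path of densities `1 + θ s`. -/
def linearPath (s : Record 𝒳 → ℝ) (θ : ℝ) (w : Record 𝒳) : ℝ := 1 + θ * s w

theorem exists_lipschitz_on_Icc {f : ℝ → ℝ} (hf : ContDiff ℝ 1 f) (R : ℝ) :
    ∃ L, 0 ≤ L ∧ ∀ a b, |a| ≤ R → |b| ≤ R → |f b - f a| ≤ L * |b - a| := by
  obtain ⟨L, hL⟩ := (isCompact_Icc (a := -R) (b := R)).exists_bound_of_continuousOn
    (hf.continuous_deriv le_rfl).continuousOn
  refine ⟨max L 0, le_max_right _ _, fun a b ha hb => ?_⟩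
  exact (convex_Icc (-R) R).norm_image_sub_le_of_norm_deriv_le
    (fun x _ => (hf.differentiable one_ne_zero) x)
    (fun x hx => (hL x hx).trans (le_max_left _ _)) (abs_le.1 ha) (abs_le.1 hb)

/-- A bounded mean zero function that is supported on a tame set of covariates. -/
structure TameScore (P : Measure (Record 𝒳)) (s : Record 𝒳 → ℝ) (C K : ℝ) : Prop where
  measurable : Measurable s
  nonneg : 0 ≤ C
  nonneg' : 0 ≤ K
  bound : ∀ w, |s w| ≤ C
  support : ∀ w, w.2.1 ∉ tameSet P K → s w = 0
  integral_eq_zero : ∫ w, s w ∂P = 0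

namespace TameScore

variable {P : Measure (Record 𝒳)} {s : Record 𝒳 → ℝ} {C K θ : ℝ}

theorem measurable_linearPath (hs : TameScore P s C K) (θ : ℝ) : Measurable (linearPath s θ) :=
  (hs.measurable.const_mul θ).const_add 1

/-- The radius `1 / (2 (C + 1))` keeps `1 + θ s` between `1/2` and `3/2`; `C + 1` instead of `C`
keeps it meaningful for `C = 0`. -/
theorem abs_mul_le (hs : TameScore P s C K) (hθ : |θ| < 1 / (2 * (C + 1))) (w : Record 𝒳) :
    |θ * s w| ≤ 1 / 2 := by
  have hC := hs.nonneg
  rw [lt_div_iff₀ (by positivity)] at hθ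
  rw [abs_mul]
  nlinarith [hs.bound w, abs_nonneg θ, abs_nonneg (s w),
    mul_le_mul_of_nonneg_left (hs.bound w) (abs_nonneg θ)]

theorem half_le (hs : TameScore P s C K) (hθ : |θ| < 1 / (2 * (C + 1))) (w : Record 𝒳) :
    1 / 2 ≤ linearPath s θ w := by
  have := (abs_le.1 (hs.abs_mul_le hθ w)).1
  unfold linearPath
  linarith

theorem le_two (hs : TameScore P s C K) (hθ : |θ| < 1 / (2 * (C + 1))) (w : Record 𝒳) :
    |linearPath s θ w| ≤ 2 := by
  have := abs_le.1 (hs.abs_mul_le hθ w)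
  rw [abs_le]
  unfold linearPath
  constructor <;> linarith

theorem ae_pos (hs : TameScore P s C K) (hθ : |θ| < 1 / (2 * (C + 1))) :
    ∀ᵐ w ∂P, 0 < linearPath s θ w :=
  Eventually.of_forall fun w => by linarith [hs.half_le hθ w]

theorem tilt_linearPath_zero : tilt P (linearPath s) 0 = P :=
  tilt_zero (Eventually.of_forall fun w => by simp [linearPath])

variable [IsProbabilityMeasure P]

theorem integrable (hs : TameScore P s C K) : Integrable s P :=
  (integrable_const C).mono' hs.measurable.aestronglyMeasurable (Eventually.of_forall hs.bound)

theorem isProbabilityMeasure_tilt (hs : TameScore P s C K) (hθ : |θ| < 1 / (2 * (C + 1))) :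
    IsProbabilityMeasure (tilt P (linearPath s) θ) := by
  have hi : Integrable (linearPath s θ) P := (integrable_const 1).add (hs.integrable.const_mul θ)
  refine ⟨?_⟩
  rw [tilt, withDensity_apply _ .univ, Measure.restrict_univ,
    ← ofReal_integral_eq_lintegral_ofReal hi (by
      filter_upwards [hs.ae_pos hθ] with w hw using hw.le)]
  unfold linearPath
  rw [integral_add (integrable_const _) (hs.integrable.const_mul θ), integral_const_mul,
    hs.integral_eq_zero]
  simp

/-- The shift `m' - m` times the normaliser `1 + θ ∫ s` equals `θ (∫ y s - m ∫ s)`. On the tame set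
the bracket is at most `2 C K` and the normaliser at least `1/2`, whence `4 C K |θ|`. Off it `s`
vanishes on the whole fibre and nothing moves. -/
theorem abs_condMean_sub_le {ψ : ℝ → Fin k → ℝ} (hs : TameScore P s C K) (h : Identified ψ P)
    (hθ : |θ| < 1 / (2 * (C + 1))) {q : Fin 3} (hq : q ≠ 2)
    (hK : ∀ x ∈ tameSet P K, ∫ y, |y| ∂((lawXY P q).condKernel x) ≤ K) :
    ∀ᵐ x ∂(obsX P),
      (x ∈ tameSet P K → |condMean P q x| ≤ K ∧
        |condMean (tilt P (linearPath s) θ) q x - condMean P q x| ≤ 4 * C * K * |θ|) ∧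
      (x ∉ tameSet P K → condMean (tilt P (linearPath s) θ) q x = condMean P q x) := by
  have := hs.isProbabilityMeasure_tilt hθ
  have hC := hs.nonneg
  have hK0 := hs.nonneg'
  have hyp : IntegrableOn (fun w : Record 𝒳 => w.2.2 * linearPath s θ w) {w | w.1 = q} P :=
    (h.integrable_outcome.mul_bdd (c := 2) (hs.measurable_linearPath θ).aestronglyMeasurable
      (Eventually.of_forall (hs.le_two hθ))).integrableOn
  refine (h.obsX_ac hq) ?_
  filter_upwards [h.ae_integrable_condKernel q, condMean_tilt_mul (hs.measurable_linearPath θ)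
    (hs.ae_pos hθ) (h.arm_ne_zero q) hyp] with x hy hx
  set κ := (lawXY P q).condKernel x
  have hsm : Measurable fun y => s (q, x, y) :=
    hs.measurable.comp (measurable_prodMk_left.comp measurable_prodMk_left)
  have is : Integrable (fun y => s (q, x, y)) κ :=
    (integrable_const C).mono' hsm.aestronglyMeasurable
      (Eventually.of_forall fun y => hs.bound (q, x, y))
  have iys : Integrable (fun y => y * s (q, x, y)) κ :=
    hy.mul_bdd hsm.aestronglyMeasurable (Eventually.of_forall fun y => hs.bound (q, x, y))
  have e1 : ∫ y, linearPath s θ (q, x, y) ∂κ = 1 + θ * ∫ y, s (q, x, y) ∂κ := by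
    unfold linearPath
    rw [integral_add (integrable_const _) (is.const_mul θ), integral_const_mul, integral_const,
      probReal_univ, one_smul]
  have e2 : ∫ y, y * linearPath s θ (q, x, y) ∂κ
      = condMean P q x + θ * ∫ y, y * s (q, x, y) ∂κ := by
    have : ∀ y, y * linearPath s θ (q, x, y) = y + θ * (y * s (q, x, y)) := fun y => by
      unfold linearPath
      ring
    simp only [this]
    rw [integral_add hy (iys.const_mul θ), integral_const_mul]
    rfl
  rw [e1, e2] at hx
  set m := condMean P q x with hm
  set m' := condMean (tilt P (linearPath s) θ) q x
  refine ⟨fun hxt => ?_, fun hxt => ?_⟩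
  · have b1 : |∫ y, s (q, x, y) ∂κ| ≤ C := by
      have := norm_integral_le_of_norm_le (f := fun y => s (q, x, y))
        (integrable_const (μ := κ) C)
        (Eventually.of_forall fun y => hs.bound (q, x, y))
      simpa using this
    have b2 : |∫ y, y * s (q, x, y) ∂κ| ≤ C * K := by
      refine (norm_integral_le_of_norm_le (f := fun y => y * s (q, x, y)) (hy.abs.const_mul C)
        (Eventually.of_forall fun y => ?_)).trans ?_
      · rw [Real.norm_eq_abs, abs_mul, mul_comm]
        exact mul_le_mul_of_nonneg_right (hs.bound _) (abs_nonneg _)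
      · rw [integral_const_mul]
        exact mul_le_mul_of_nonneg_left (hK x hxt) hC
    have b3 : |m| ≤ K := (abs_integral_le_integral_abs).trans (hK x hxt)
    refine ⟨b3, ?_⟩
    have g1 : 1 / 2 ≤ 1 + θ * ∫ y, s (q, x, y) ∂κ := by
      have hb : |θ * ∫ y, s (q, x, y) ∂κ| ≤ 1 / 2 := by
        rw [lt_div_iff₀ (by positivity)] at hθ
        rw [abs_mul]
        nlinarith [mul_le_mul_of_nonneg_left b1 (abs_nonneg θ), abs_nonneg θ]
      linarith [(abs_le.1 hb).1]
    have g2 : (m' - m) * (1 + θ * ∫ y, s (q, x, y) ∂κ)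
        = θ * ((∫ y, y * s (q, x, y) ∂κ) - m * ∫ y, s (q, x, y) ∂κ) := by
      rw [sub_mul, hx]
      ring
    have g3 : |m' - m| * (1 / 2) ≤ |θ| * (2 * C * K) := by
      refine (mul_le_mul_of_nonneg_left (g1.trans (le_abs_self _)) (abs_nonneg _)).trans ?_
      rw [← abs_mul, g2, abs_mul]
      refine mul_le_mul_of_nonneg_left ((abs_sub _ _).trans ?_) (abs_nonneg _)
      rw [abs_mul]
      have := mul_le_mul b3 b1 (abs_nonneg _) hK0
      linarith
    linarith
  · have z : ∀ y, s (q, x, y) = 0 := fun y => hs.support (q, x, y) hxt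
    simpa [z] using hx

theorem abs_comp_contrast_sub_le {ψ : ℝ → Fin k → ℝ} (hs : TameScore P s C K)
    (h : Identified ψ P) {f : ℝ → ℝ} (hf : ContDiff ℝ 1 f) :
    ∃ L, 0 ≤ L ∧ ∀ θ, |θ| < 1 / (2 * (C + 1)) → ∀ᵐ w ∂P,
      |f (contrast (tilt P (linearPath s) θ) w.2.1) - f (contrast P w.2.1)| ≤ L * |θ| := by
  have hC := hs.nonneg
  have hK := hs.nonneg'
  -- On the tame set `|Δ| ≤ 2K`, and the contrast moves by at most `8 C K |θ| ≤ 4K`, so both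
  -- contrasts lie in `[-6K, 6K]`.
  obtain ⟨L, hL0, hL⟩ := exists_lipschitz_on_Icc hf (6 * K)
  refine ⟨L * (8 * C * K), by positivity, fun θ hθ => h.ae_of_ae_obsX (p := fun x =>
    |f (contrast (tilt P (linearPath s) θ) x) - f (contrast P x)| ≤ L * (8 * C * K) * |θ|) ?_⟩
  filter_upwards [hs.abs_condMean_sub_le h hθ (q := 0) (by decide) fun x hx => hx.1,
    hs.abs_condMean_sub_le h hθ (q := 1) (by decide) fun x hx => hx.2] with x h0 h1
  by_cases hx : x ∈ tameSet P K
  · obtain ⟨a0, b0⟩ := h0.1 hx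
    obtain ⟨a1, b1⟩ := h1.1 hx
    have c1 : |contrast P x| ≤ 2 * K := (abs_sub _ _).trans (by linarith)
    have c2 : |contrast (tilt P (linearPath s) θ) x - contrast P x| ≤ 8 * C * K * |θ| := by
      have e : contrast (tilt P (linearPath s) θ) x - contrast P x
          = (condMean (tilt P (linearPath s) θ) 1 x - condMean P 1 x)
            - (condMean (tilt P (linearPath s) θ) 0 x - condMean P 0 x) := by
        unfold contrast
        ring
      rw [e]
      exact (abs_sub _ _).trans (by linarith)
    have c3 : 8 * C * K * |θ| ≤ 4 * K := by
      rw [lt_div_iff₀ (by positivity)] at hθ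
      nlinarith [mul_nonneg hK (abs_nonneg θ)]
    have c4 : |contrast (tilt P (linearPath s) θ) x| ≤ 6 * K := by
      have := abs_add_le (contrast (tilt P (linearPath s) θ) x - contrast P x) (contrast P x)
      rw [sub_add_cancel] at this
      linarith
    calc _ ≤ L * |contrast (tilt P (linearPath s) θ) x - contrast P x| :=
          hL _ _ (by linarith) c4
      _ ≤ L * (8 * C * K * |θ|) := mul_le_mul_of_nonneg_left c2 hL0
      _ = _ := by ring
  · have e : contrast (tilt P (linearPath s) θ) x = contrast P x := by
      unfold contrast
      rw [h0.2 hx, h1.2 hx]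
    rw [e, sub_self, abs_zero]
    positivity

/-- The increment splits into the change of `f(Δ_θ)`, uniformly of order `θ`, and the change `θ s`
of the density. Hence integrability of `g` and of `g f(Δ)` suffices. -/
theorem dominatedQuotients {ψ : ℝ → Fin k → ℝ} (hs : TameScore P s C K)
    (h : Identified ψ P) {f : ℝ → ℝ} (hf : ContDiff ℝ 1 f) {g : Record 𝒳 → ℝ}
    (hg : Integrable g P) (hgf : Integrable (fun w => g w * f (contrast P w.2.1)) P) :
    DominatedQuotients P (1 / (2 * (C + 1))) fun θ w =>
      g w * f (contrast (tilt P (linearPath s) θ) w.2.1) * linearPath s θ w := by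
  obtain ⟨L, hL0, hL⟩ := hs.abs_comp_contrast_sub_le h hf
  refine ⟨fun w => |g w| * (2 * L) + |g w * f (contrast P w.2.1)| * C,
    (hg.abs.mul_const _).add (hgf.abs.mul_const _), fun θ hθ => ?_⟩
  filter_upwards [hL θ hθ] with w hw
  set a := f (contrast (tilt P (linearPath s) θ) w.2.1)
  rw [tilt_linearPath_zero]
  set b := f (contrast P w.2.1)
  have e : g w * a * linearPath s θ w - g w * b * linearPath s 0 w
      = g w * ((a - b) * linearPath s θ w) + g w * b * (θ * s w) := by
    unfold linearPath
    ring
  rw [e, add_mul]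
  refine (abs_add_le _ _).trans (add_le_add ?_ ?_)
  · rw [abs_mul, abs_mul, mul_assoc]
    refine mul_le_mul_of_nonneg_left ?_ (abs_nonneg _)
    calc |a - b| * |linearPath s θ w| ≤ (L * |θ|) * 2 :=
          mul_le_mul hw (hs.le_two hθ w) (abs_nonneg _) (by positivity)
      _ = 2 * L * |θ| := by ring
  · rw [abs_mul, abs_mul θ, mul_assoc]
    refine mul_le_mul_of_nonneg_left ?_ (abs_nonneg _)
    rw [mul_comm]
    exact mul_le_mul_of_nonneg_right (hs.bound w) (abs_nonneg _)

/-- The submodel `dP_θ = (1 + θ s) dP`. -/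
def submodel {ψ : ℝ → Fin k → ℝ} (hs : TameScore P s C K) (h : Identified ψ P) :
    SmoothSubmodel ψ P where
  ε := 1 / (2 * (C + 1))
  ε_pos := by
    have := hs.nonneg
    positivity
  p := linearPath s
  score := s
  measurable_p := hs.measurable_linearPath
  p_pos θ hθ := hs.ae_pos hθ
  isProb θ hθ := hs.isProbabilityMeasure_tilt hθ
  p_zero := Eventually.of_forall fun w => by simp [linearPath]
  hasDeriv := Eventually.of_forall fun w => by
    simpa [linearPath] using ((hasDerivAt_id (0 : ℝ)).mul_const (s w)).const_add 1
  memLp_score := MemLp.of_bound hs.measurable.aestronglyMeasurable C (Eventually.of_forall hs.bound)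
  dom_mass := by
    simpa using hs.dominatedQuotients h (f := fun _ => 1) contDiff_const (g := fun _ => 1)
      (integrable_const _) (integrable_const _)
  dom_condMean := by
    have hi : Integrable (fun w : Record 𝒳 => obsInd w * w.2.2) P := by
      rw [obsInd_mul, integrable_indicator_iff measurableSet_obs]
      exact h.integrable_outcome.integrableOn
    convert hs.dominatedQuotients h (f := fun _ => 1) contDiff_const hi (by simpa using hi)
      using 3 with θ w
    by_cases hq : w.1 = 2 <;> simp [obsInd, hq]
  dom_obsMoment j := by
    have := h.isProbabilityMeasure_obsLaw
    convert hs.dominatedQuotients h (f := fun t => ψ t j) (contDiff_pi.1 h.contDiff j)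
      (by simpa using h.integrable_obsInd_mul (integrable_const (1 : ℝ)))
      (h.integrable_obsInd_mul (h.integrable_feat j)) using 3 with θ w
    by_cases hq : w.1 = 2 <;> simp [obsInd, hq, feat]
  dom_gram i j := by
    have := h.isProbabilityMeasure_rctLaw
    convert hs.dominatedQuotients h (f := fun t => ψ t i * ψ t j)
      ((contDiff_pi.1 h.contDiff i).mul (contDiff_pi.1 h.contDiff j))
      (by simpa using h.integrable_rctInd_mul (integrable_const (1 : ℝ)))
      (h.integrable_rctInd_mul (h.integrable_gram i j)) using 3 with θ w
    by_cases hq : w.1 = 2 <;> simp [rctInd, hq, feat]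
  dom_crossMoment j := by
    have hi : Integrable (fun w : Record 𝒳 => rctInd w * w.2.2) P := by
      rw [rctInd_mul, integrable_indicator_iff (measurableSet_arm 2)]
      exact h.integrable_outcome.integrableOn
    convert hs.dominatedQuotients h (f := fun t => ψ t j) (contDiff_pi.1 h.contDiff j) hi
      ((h.integrable_rctInd_mul (h.integrable_cross j)).congr (by simp [mul_assoc, feat]))
      using 3 with θ w
    by_cases hq : w.1 = 2 <;> simp [rctInd, hq, feat]

end TameScore

/-! ### Centred truncations -/

/-- The records at which `φ` is at most `n` in absolute value and the covariate is tame. -/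
def truncSet (P : Measure (Record 𝒳)) (φ : Record 𝒳 → ℝ) (n : ℕ) : Set (Record 𝒳) :=
  {w | |φ w| ≤ n} ∩ {w | w.2.1 ∈ tameSet P n}

/-- The mean of `φ` over `truncSet P φ n`. -/
def truncMean (P : Measure (Record 𝒳)) (φ : Record 𝒳 → ℝ) (n : ℕ) : ℝ :=
  (P.real (truncSet P φ n))⁻¹ * ∫ w in truncSet P φ n, φ w ∂P

/-- The restriction of `φ` to `truncSet P φ n`, centred there. -/
def truncScore (P : Measure (Record 𝒳)) (φ : Record 𝒳 → ℝ) (n : ℕ) : Record 𝒳 → ℝ :=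
  (truncSet P φ n).indicator fun w => φ w - truncMean P φ n

section

variable {P : Measure (Record 𝒳)} {φ : Record 𝒳 → ℝ}

theorem measurableSet_truncSet (hφ : Measurable φ) (n : ℕ) : MeasurableSet (truncSet P φ n) :=
  (measurableSet_le hφ.abs measurable_const).inter
    (measurable_covariate (measurableSet_tameSet P n))

theorem truncSet_mono : Monotone (truncSet P φ) := fun n m hnm w hw => by
  have h : (n : ℝ) ≤ m := Nat.cast_le.2 hnm
  exact ⟨le_trans (show |φ w| ≤ n from hw.1) h, hw.2.1.trans h, hw.2.2.trans h⟩

theorem aecover_truncSet (hφ : Measurable φ) : AECover P atTop (truncSet P φ) where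
  ae_eventually_mem := Eventually.of_forall fun w => by
    obtain ⟨n, hn⟩ := exists_nat_ge (max |φ w| (max (∫ y, |y| ∂((lawXY P 0).condKernel w.2.1))
      (∫ y, |y| ∂((lawXY P 1).condKernel w.2.1))))
    filter_upwards [eventually_ge_atTop n] with m hm
    exact truncSet_mono hm ⟨(le_max_left _ _).trans hn,
      (le_max_left _ _).trans ((le_max_right _ _).trans hn),
      (le_max_right _ _).trans ((le_max_right _ _).trans hn)⟩
  measurableSet := measurableSet_truncSet hφ

variable [IsProbabilityMeasure P]

theorem tendsto_measureReal_truncSet (hφ : Measurable φ) :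
    Tendsto (fun n => P.real (truncSet P φ n)) atTop (𝓝 1) := by
  simpa using (aecover_truncSet hφ).integral_tendsto_of_countably_generated
    (integrable_const (μ := P) (1 : ℝ))

theorem integrableOn_truncSet (hφ : Measurable φ) (n : ℕ) :
    IntegrableOn φ (truncSet P φ n) P := by
  refine Measure.integrableOn_of_bounded (M := n) (measure_ne_top _ _)
    hφ.aestronglyMeasurable ?_
  exact (ae_restrict_iff' (measurableSet_truncSet hφ n)).2 (Eventually.of_forall fun w hw => hw.1)

theorem integrableOn_truncSet_sq (hφ : Measurable φ) (n : ℕ) :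
    IntegrableOn (fun w => φ w ^ 2) (truncSet P φ n) P := by
  refine Measure.integrableOn_of_bounded (M := (n : ℝ) ^ 2) (measure_ne_top _ _)
    (hφ.pow_const 2).aestronglyMeasurable ?_
  refine (ae_restrict_iff' (measurableSet_truncSet hφ n)).2 (Eventually.of_forall fun w hw => ?_)
  rw [Real.norm_eq_abs, abs_pow]
  exact pow_le_pow_left₀ (abs_nonneg _) hw.1 2

theorem integral_truncSet_eq (n : ℕ) :
    ∫ w in truncSet P φ n, φ w ∂P = truncMean P φ n * P.real (truncSet P φ n) := by
  by_cases h : P.real (truncSet P φ n) = 0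
  · rw [h, mul_zero]
    refine setIntegral_measure_zero _ ?_
    exact (measureReal_eq_zero_iff (measure_ne_top _ _)).1 h
  · rw [truncMean]
    field_simp

theorem tameScore_truncScore (hφ : Measurable φ) (n : ℕ) :
    TameScore P (truncScore P φ n) (n + |truncMean P φ n|) n where
  measurable := (hφ.sub_const _).indicator (measurableSet_truncSet hφ n)
  nonneg := by positivity
  nonneg' := by positivity
  bound w := by
    by_cases hw : w ∈ truncSet P φ n
    · rw [truncScore, Set.indicator_of_mem hw]
      exact (abs_sub _ _).trans (add_le_add_left hw.1 _)
    · rw [truncScore, Set.indicator_of_notMem hw, abs_zero]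
      positivity
  support w hw := Set.indicator_of_notMem (fun h => hw h.2) _
  integral_eq_zero := by
    rw [truncScore, integral_indicator (measurableSet_truncSet hφ n),
      integral_sub (integrableOn_truncSet hφ n) (integrable_const _), integral_truncSet_eq,
      setIntegral_const, smul_eq_mul, mul_comm, sub_self]

theorem integral_truncScore_sq (hφ : Measurable φ) (n : ℕ) :
    ∫ w, truncScore P φ n w ^ 2 ∂P = ∫ w in truncSet P φ n, φ w ^ 2 ∂P
      - (P.real (truncSet P φ n))⁻¹ * (∫ w in truncSet P φ n, φ w ∂P) ^ 2 := by
  have e : (fun w => truncScore P φ n w ^ 2) = (truncSet P φ n).indicator fun w =>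
      φ w ^ 2 - (2 * truncMean P φ n * φ w - truncMean P φ n ^ 2) := by
    ext w
    by_cases hw : w ∈ truncSet P φ n
    · rw [truncScore, Set.indicator_of_mem hw, Set.indicator_of_mem hw]
      ring
    · rw [truncScore, Set.indicator_of_notMem hw, Set.indicator_of_notMem hw]
      ring
  have i1 := (integrableOn_truncSet (P := P) hφ n).const_mul (2 * truncMean P φ n)
  have i2 : IntegrableOn (fun w => 2 * truncMean P φ n * φ w - truncMean P φ n ^ 2)
    (truncSet P φ n) P := i1.sub (integrable_const _)
  rw [e, integral_indicator (measurableSet_truncSet hφ n),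
    integral_sub (integrableOn_truncSet_sq hφ n) i2,
    integral_sub i1 (integrable_const _), integral_const_mul, setIntegral_const, smul_eq_mul,
    integral_truncSet_eq]
  by_cases h : P.real (truncSet P φ n) = 0
  · simp [h]
  · field_simp
    ring

/-- On the truncation set `φ` and its centred version differ by a constant, to which the centred
version is orthogonal. `φ` is bounded there, so it need not be integrable globally. -/
theorem integral_mul_truncScore (hφ : Measurable φ) (n : ℕ) :
    Integrable (fun w => φ w * truncScore P φ n w) P ∧
      ∫ w, φ w * truncScore P φ n w ∂P = ∫ w, truncScore P φ n w ^ 2 ∂P := by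
  have e : (fun w => φ w * truncScore P φ n w) = (truncSet P φ n).indicator fun w =>
      φ w ^ 2 - truncMean P φ n * φ w := by
    ext w
    by_cases hw : w ∈ truncSet P φ n
    · rw [truncScore, Set.indicator_of_mem hw, Set.indicator_of_mem hw]
      ring
    · rw [truncScore, Set.indicator_of_notMem hw, Set.indicator_of_notMem hw, mul_zero]
  have i1 := (integrableOn_truncSet (P := P) hφ n).const_mul (truncMean P φ n)
  have hS := measurableSet_truncSet (P := P) hφ n
  rw [integral_truncScore_sq hφ, e]
  refine ⟨((integrableOn_truncSet_sq hφ n).sub i1).integrable_indicator hS, ?_⟩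
  rw [integral_indicator hS, integral_sub (integrableOn_truncSet_sq hφ n) i1, integral_const_mul,
    truncMean]
  ring

theorem tendsto_integral_truncScore_sq (hφ : Measurable φ) (h2 : MemLp φ 2 P)
    (h0 : ∫ w, φ w ∂P = 0) :
    Tendsto (fun n => ∫ w, truncScore P φ n w ^ 2 ∂P) atTop (𝓝 (∫ w, φ w ^ 2 ∂P)) := by
  have hc := aecover_truncSet (P := P) hφ
  have t1 := hc.integral_tendsto_of_countably_generated h2.integrable_sq
  have t2 := hc.integral_tendsto_of_countably_generated (h2.integrable one_le_two)
  have t3 := tendsto_measureReal_truncSet (P := P) hφ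
  rw [h0] at t2
  have := t1.sub ((t3.inv₀ one_ne_zero).mul (t2.pow 2))
  simp only [integral_truncScore_sq hφ]
  simpa using this

/-- As `φ` is not known to be integrable, the centring constants `c_n` could a priori diverge. On a
fixed truncation set of positive mass, `c_n² ≤ 2 (φ - c_n)² + 2 φ²` bounds them uniformly by `W`;
then `φ² ≤ 2 (φ - c_n)² + 2 W` bounds the truncated second moments. -/
theorem memLp_of_integral_truncScore_sq_le (hφ : Measurable φ) {V : ℝ}
    (hV : ∀ n, ∫ w, truncScore P φ n w ^ 2 ∂P ≤ V) : MemLp φ 2 P := by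
  have hc := aecover_truncSet (P := P) hφ
  have t3 := tendsto_measureReal_truncSet (P := P) hφ
  obtain ⟨N, hN⟩ := (t3.eventually (lt_mem_nhds (show (0 : ℝ) < 1 by norm_num))).exists
  have hm := measurableSet_truncSet (P := P) hφ
  have isq : ∀ n, Integrable (fun w => truncScore P φ n w ^ 2) P := fun n => by
    have hs := tameScore_truncScore (P := P) hφ n
    exact (MemLp.of_bound hs.measurable.aestronglyMeasurable _
      (Eventually.of_forall hs.bound) : MemLp _ 2 P).integrable_sq
  have hV' : ∀ n m, ∫ w in truncSet P φ m, truncScore P φ n w ^ 2 ∂P ≤ V := fun n m =>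
    (setIntegral_le_integral (isq n) (Eventually.of_forall fun w => sq_nonneg _)).trans (hV n)
  set I := ∫ w in truncSet P φ N, φ w ^ 2 ∂P
  set W := (P.real (truncSet P φ N))⁻¹ * (2 * V + 2 * I)
  have hW : ∀ n, N ≤ n → truncMean P φ n ^ 2 ≤ W := fun n hn => by
    have h1 : ∫ _ in truncSet P φ N, truncMean P φ n ^ 2 ∂P
        ≤ ∫ w in truncSet P φ N, (2 * truncScore P φ n w ^ 2 + 2 * φ w ^ 2) ∂P := by
      refine setIntegral_mono_on (integrable_const _)
        (((isq n).integrableOn.const_mul 2).add ((integrableOn_truncSet_sq hφ N).const_mul 2))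
        (hm N) fun w hw => ?_
      rw [truncScore, Set.indicator_of_mem (truncSet_mono hn hw)]
      nlinarith [sq_nonneg (2 * φ w - truncMean P φ n)]
    rw [integral_add ((isq n).integrableOn.const_mul 2)
      ((integrableOn_truncSet_sq hφ N).const_mul 2), integral_const_mul, integral_const_mul,
      setIntegral_const, smul_eq_mul] at h1
    change _ ≤ _⁻¹ * _
    rw [inv_mul_eq_div, le_div_iff₀ hN]
    linarith [hV' n N]
  rw [memLp_two_iff_integrable_sq hφ.aestronglyMeasurable]
  refine hc.integrable_of_integral_bounded_of_nonneg_ae (2 * V + 2 * W)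
    (integrableOn_truncSet_sq hφ) (Eventually.of_forall fun w => sq_nonneg _) ?_
  filter_upwards [eventually_ge_atTop N] with n hn
  have h1 : ∫ w in truncSet P φ n, φ w ^ 2 ∂P
      ≤ ∫ w in truncSet P φ n, (2 * truncScore P φ n w ^ 2 + 2 * W) ∂P := by
    refine setIntegral_mono_on (integrableOn_truncSet_sq hφ n)
      (((isq n).integrableOn.const_mul 2).add (integrable_const _)) (hm n) fun w hw => ?_
    rw [truncScore, Set.indicator_of_mem hw]
    nlinarith [sq_nonneg (φ w - 2 * truncMean P φ n), hW n hn]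
  rw [integral_add ((isq n).integrableOn.const_mul 2) (integrable_const _), integral_const_mul,
    setIntegral_const, smul_eq_mul] at h1
  have hW0 : 0 ≤ W := (sq_nonneg _).trans (hW N le_rfl)
  have hle : P.real (truncSet P φ n) ≤ 1 := measureReal_le_one
  nlinarith [hV' n n]

end

/-! ### Tangent space, efficient influence function and efficiency bound -/

theorem inner_toLp {P : Measure (Record 𝒳)} {f : Record 𝒳 → ℝ} (hf : MemLp f 2 P)
    (g : Lp ℝ 2 P) : inner ℝ hf.toLp g = ∫ w, g w * f w ∂P := by
  rw [L2.inner_def]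
  refine integral_congr_ae ?_
  filter_upwards [hf.coeFn_toLp] with w hw
  rw [hw]
  rfl

section

variable {ψ : ℝ → Fin k → ℝ} {P : Measure (Record 𝒳)}

theorem integral_mul_sq_le {f g : Record 𝒳 → ℝ} (hf : MemLp f 2 P) (hg : MemLp g 2 P) :
    (∫ w, f w * g w ∂P) ^ 2 ≤ (∫ w, f w ^ 2 ∂P) * ∫ w, g w ^ 2 ∂P := by
  have e : ∀ {u v : Record 𝒳 → ℝ} (hu : MemLp u 2 P) (hv : MemLp v 2 P),
      inner ℝ hu.toLp hv.toLp = ∫ w, u w * v w ∂P := fun hu hv => by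
    rw [inner_toLp]
    refine integral_congr_ae ?_
    filter_upwards [hv.coeFn_toLp] with w hw
    rw [hw, mul_comm]
  have := real_inner_mul_inner_self_le hf.toLp hg.toLp
  simp only [e, ← pow_two] at this
  exact this

theorem memLp_eif (hψ : ContDiff ℝ 1 ψ) (hV : Veff ψ P < ∞) : MemLp (eif ψ P) 2 P := by
  have hm := measurable_eif hψ P
  rw [memLp_two_iff_integrable_sq hm.aestronglyMeasurable]
  refine ⟨(hm.pow_const 2).aestronglyMeasurable, ?_⟩
  rwa [hasFiniteIntegral_iff_ofReal (Eventually.of_forall fun w => sq_nonneg _)]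

theorem Veff_eq (h2 : MemLp (eif ψ P) 2 P) :
    Veff ψ P = ENNReal.ofReal (∫ w, eif ψ P w ^ 2 ∂P) := by
  rw [Veff, ofReal_integral_eq_lintegral_ofReal h2.integrable_sq
    (Eventually.of_forall fun w => sq_nonneg _)]

theorem SmoothSubmodel.toLp_score_mem (M : SmoothSubmodel ψ P) : M.memLp_score.toLp ∈ tangentSpace ψ P :=
  Submodule.le_topologicalClosure _ (Submodule.subset_span ⟨M, M.memLp_score.coeFn_toLp⟩)

theorem mem_orthogonal_tangentSpace_iff (g : Lp ℝ 2 P) :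
    g ∈ (tangentSpace ψ P)ᗮ ↔ ∀ M : SmoothSubmodel ψ P, ∫ w, g w * M.score w ∂P = 0 := by
  constructor
  · intro hg M
    rw [← inner_toLp M.memLp_score]
    exact (Submodule.mem_orthogonal _ _).1 hg _ M.toLp_score_mem
  · intro hg
    rw [tangentSpace, Submodule.orthogonal_closure, Submodule.mem_orthogonal]
    intro u hu
    induction hu using Submodule.span_induction with
    | mem x hx =>
      obtain ⟨M, hM⟩ := hx
      rw [← hg M, L2.inner_def]
      refine integral_congr_ae ?_
      filter_upwards [hM] with w hw
      rw [hw]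
      rfl
    | zero => exact inner_zero_left _
    | add x y _ _ hx hy => rw [inner_add_left, hx, hy, add_zero]
    | smul a x _ hx => rw [inner_smul_left, hx, mul_zero]

/-- The difference of two such functions lies in the tangent space and, representing the derivative
zero, is orthogonal to it. -/
theorem IsEfficientInfluenceFunction.ae_eq {φ φ' : Record 𝒳 → ℝ}
    (h : IsEfficientInfluenceFunction ψ P φ) (h' : IsEfficientInfluenceFunction ψ P φ') :
    φ =ᵐ[P] φ' := by
  rw [← MemLp.toLp_eq_toLp_iff h.memLp h'.memLp, ← sub_eq_zero, ← Submodule.mem_bot ℝ,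
    ← Submodule.inf_orthogonal_eq_bot (tangentSpace ψ P)]
  refine ⟨Submodule.sub_mem _ h.mem_tangentSpace h'.mem_tangentSpace, ?_⟩
  refine (mem_orthogonal_tangentSpace_iff _).2 fun M => ?_
  have e := (h.gradient M).unique (h'.gradient M)
  have hi : Integrable (fun w => φ w * M.score w) P := h.memLp.integrable_mul M.memLp_score
  have hi' : Integrable (fun w => φ' w * M.score w) P := h'.memLp.integrable_mul M.memLp_score
  rw [← sub_eq_zero, ← integral_sub hi hi'] at e
  rw [← e]
  refine integral_congr_ae ?_
  filter_upwards [Lp.coeFn_sub h.memLp.toLp h'.memLp.toLp, h.memLp.coeFn_toLp,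
    h'.memLp.coeFn_toLp] with w h1 h2 h3
  rw [h1, Pi.sub_apply, h2, h3, sub_mul]

variable [IsProbabilityMeasure P]

namespace SmoothSubmodel

variable (M : SmoothSubmodel ψ P)

theorem integral_score : ∫ w, M.score w ∂P = 0 := by
  have hp0 : Integrable (M.p 0) P :=
    (integrable_const (1 : ℝ)).congr (by filter_upwards [M.p_zero] with w hw using hw.symm)
  have h1 := (M.dom_mass.hasDerivAt_integral (D := M.score) M.ε_pos
    (fun θ _ => (M.measurable_p θ).aestronglyMeasurable) hp0
    fun u hu hu0 => M.tendsto_slope_p (fun n => (hu n).2) hu0).2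
  have h2 : (fun θ => ∫ w, M.p θ w ∂P) =ᶠ[𝓝 0] fun _ => 1 := by
    have : ∀ᶠ t : ℝ in 𝓝 0, |t| < M.ε := by
      have := continuous_abs.tendsto (0 : ℝ)
      rw [abs_zero] at this
      exact this.eventually (gt_mem_nhds M.ε_pos)
    filter_upwards [this] with θ hθ
    have := M.isProb θ hθ
    have := setIntegral_tilt (M.measurable_p θ) (M.p_pos θ hθ) .univ fun _ => (1 : ℝ)
    simpa using this.symm
  exact h1.unique ((hasDerivAt_const (0 : ℝ) (1 : ℝ)).congr_of_eventuallyEq h2)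

end SmoothSubmodel

/-- The constant 1 is orthogonal to every score, hence to their closed span. -/
theorem integral_eq_zero_of_mem_tangentSpace {g : Lp ℝ 2 P} (hg : g ∈ tangentSpace ψ P) :
    ∫ w, g w ∂P = 0 := by
  have h1 : MemLp (fun _ : Record 𝒳 => (1 : ℝ)) 2 P := memLp_const 1
  have h : h1.toLp ∈ (tangentSpace ψ P)ᗮ := by
    rw [mem_orthogonal_tangentSpace_iff]
    intro M
    rw [← M.integral_score]
    refine integral_congr_ae ?_
    filter_upwards [h1.coeFn_toLp] with w hw
    rw [hw, one_mul]
  have := (Submodule.mem_orthogonal' _ _).1 h g hg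
  rw [inner_toLp] at this
  simpa using this

namespace Identified

theorem mem_tangentSpace_iff (h : Identified ψ P) (g : Lp ℝ 2 P) :
    g ∈ tangentSpace ψ P ↔ ∫ w, g w ∂P = 0 := by
  refine ⟨integral_eq_zero_of_mem_tangentSpace, fun hg => ?_⟩
  have : CompleteSpace (tangentSpace ψ P) :=
    (Submodule.isClosed_topologicalClosure _).completeSpace_coe
  -- The component `z` orthogonal to the tangent space inherits mean zero. Its truncations are
  -- scores, so their pairings with `z`, which are their squared norms, vanish.
  obtain ⟨y, hy, z, hz, rfl⟩ := (tangentSpace ψ P).exists_add_mem_mem_orthogonal g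
  have hy0 := integral_eq_zero_of_mem_tangentSpace hy
  have hz0 : ∫ w, z w ∂P = 0 := by
    rw [integral_congr_ae (Lp.coeFn_add y z)] at hg
    simp only [Pi.add_apply] at hg
    rw [integral_add ((Lp.memLp y).integrable one_le_two) ((Lp.memLp z).integrable one_le_two),
      hy0, zero_add] at hg
    exact hg
  have hm : Measurable (z : Record 𝒳 → ℝ) := (Lp.stronglyMeasurable z).measurable
  have hs : ∀ n, ∫ w, truncScore P z n w ^ 2 ∂P = 0 := fun n => by
    rw [← (integral_mul_truncScore hm n).2]
    exact (mem_orthogonal_tangentSpace_iff z).1 hz ((tameScore_truncScore hm n).submodel h)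
  have ht := tendsto_integral_truncScore_sq hm (Lp.memLp z) hz0
  simp only [hs] at ht
  have hsq := tendsto_nhds_unique ht tendsto_const_nhds
  have hz1 : z = 0 := by
    rw [← norm_eq_zero, ← sq_eq_zero_iff, ← real_inner_self_eq_norm_sq, L2.inner_def, ← hsq]
    exact integral_congr_ae (Eventually.of_forall fun w => (pow_two (z w)).symm)
  rw [hz1, add_zero]
  exact hy

theorem hasDerivAt_tau_of_integrable (h : Identified ψ P) (M : SmoothSubmodel ψ P)
    (hint : Integrable (fun w => eif ψ P w * M.score w) P) :
    HasDerivAt M.tau (∫ w, eif ψ P w * M.score w ∂P) 0 := by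
  rw [h.integral_eif_mul_score M hint]
  exact (M.hasDerivAt_tau h).2

theorem isEfficientInfluenceFunction_eif (h : Identified ψ P) (hV : Veff ψ P < ∞) :
    IsEfficientInfluenceFunction ψ P (eif ψ P) where
  memLp := memLp_eif h.contDiff hV
  mem_tangentSpace := by
    rw [h.mem_tangentSpace_iff, integral_congr_ae (memLp_eif h.contDiff hV).coeFn_toLp]
    exact h.integral_eif_eq_zero ((memLp_eif h.contDiff hV).integrable one_le_two)
  gradient M := h.hasDerivAt_tau_of_integrable M
    ((memLp_eif h.contDiff hV).integrable_mul M.memLp_score)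

end Identified

namespace Identified

theorem efficiencyBound_eq (h : Identified ψ P) : efficiencyBound ψ P = Veff ψ P := by
  have hm := measurable_eif h.contDiff P
  have hlow : ∀ n, ENNReal.ofReal (∫ w, truncScore P (eif ψ P) n w ^ 2 ∂P)
      ≤ efficiencyBound ψ P := fun n => by
    obtain ⟨hi, he⟩ := integral_mul_truncScore (P := P) hm n
    have hs := tameScore_truncScore (P := P) hm n
    have hd := h.hasDerivAt_tau_of_integrable (hs.submodel h) hi
    refine le_sSup ⟨hs.submodel h, _, hd, ?_⟩
    change _ = ENNReal.ofReal ((∫ w, eif ψ P w * truncScore P (eif ψ P) n w ∂P) ^ 2)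
      / ENNReal.ofReal (∫ w, truncScore P (eif ψ P) n w ^ 2 ∂P)
    rw [he]
    have h0 : 0 ≤ ∫ w, truncScore P (eif ψ P) n w ^ 2 ∂P :=
      integral_nonneg fun w => sq_nonneg _
    -- A truncation that is almost surely zero contributes `0 / 0 = 0`.
    rcases h0.eq_or_lt with h1 | h1
    · simp [← h1]
    · rw [← ENNReal.ofReal_div_of_pos h1, pow_two, mul_div_cancel_right₀ _ h1.ne']
  refine le_antisymm (sSup_le ?_) ?_
  · rintro b ⟨M, d, hd, rfl⟩
    rcases eq_or_ne (Veff ψ P) ∞ with hV | hV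
    · rw [hV]
      exact le_top
    have h2 := memLp_eif h.contDiff (lt_top_iff_ne_top.2 hV)
    refine ENNReal.div_le_of_le_mul ?_
    rw [hd.unique (h.hasDerivAt_tau_of_integrable M (h2.integrable_mul M.memLp_score)),
      Veff_eq h2, ← ENNReal.ofReal_mul (integral_nonneg fun w => sq_nonneg _)]
    exact ENNReal.ofReal_le_ofReal (integral_mul_sq_le h2 M.memLp_score)
  · rcases eq_or_ne (efficiencyBound ψ P) ∞ with hB | hB
    · rw [hB]
      exact le_top
    -- Square integrability of `φ` is deduced from finiteness of the bound, so `V_eff = ∞` forces an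
    -- infinite bound.
    have h2 : MemLp (eif ψ P) 2 P := memLp_of_integral_truncScore_sq_le hm
      (V := (efficiencyBound ψ P).toReal) fun n => (ENNReal.ofReal_le_iff_le_toReal hB).1 (hlow n)
    rw [Veff_eq h2]
    exact le_of_tendsto (ENNReal.tendsto_ofReal (tendsto_integral_truncScore_sq hm h2
      (h.integral_eif_eq_zero (h2.integrable one_le_two)))) (Eventually.of_forall hlow)

end Identified

end

/-! ### The regime of a vanishing experiment -/

theorem alphaBar_dotProduct_meatIntegrand (ψ : ℝ → Fin k → ℝ) (P : Measure (Record 𝒳))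
    (w : Record 𝒳) : alphaBar ψ P ⬝ᵥ (meatIntegrand ψ P w *ᵥ alphaBar ψ P)
      = ((w.2.2 - muBar ψ P w.2.1) * (alphaBar ψ P ⬝ᵥ feat ψ P w.2.1)) ^ 2 := by
  have h : vecMulVec (feat ψ P w.2.1) (feat ψ P w.2.1) *ᵥ alphaBar ψ P
      = (feat ψ P w.2.1 ⬝ᵥ alphaBar ψ P) • feat ψ P w.2.1 := by
    ext i
    simp only [Matrix.mulVec, dotProduct, vecMulVec_apply, Pi.smul_apply, smul_eq_mul,
      Finset.sum_mul]
    exact Finset.sum_congr rfl fun j _ => by ring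
  rw [meatIntegrand, Matrix.smul_mulVec, h, dotProduct_smul, dotProduct_smul, smul_eq_mul,
    smul_eq_mul, dotProduct_comm (feat ψ P w.2.1)]
  ring

theorem Sig_eq_of_integrable {ψ : ℝ → Fin k → ℝ} {P : Measure (Record 𝒳)}
    (h : ∀ i j, Integrable (fun w => meatIntegrand ψ P w i j) (rctLaw P)) :
    Sig ψ P = alphaBar ψ P ⬝ᵥ (meat ψ P *ᵥ alphaBar ψ P) := by
  have h1 : ∀ i j, Integrable (fun w => meatIntegrand ψ P w i j * alphaBar ψ P j) (rctLaw P) :=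
    fun i j => (h i j).mul_const _
  have h2 : ∀ i, Integrable (fun w => ∑ j, meatIntegrand ψ P w i j * alphaBar ψ P j) (rctLaw P) :=
    fun i => integrable_finsetSum _ fun j _ => h1 i j
  simp only [Sig, meat, Matrix.mulVec, dotProduct, Matrix.of_apply]
  rw [integral_finsetSum _ fun i _ => (h2 i).const_mul _]
  refine Finset.sum_congr rfl fun i _ => ?_
  rw [integral_const_mul, integral_finsetSum _ fun j _ => h1 i j]
  simp only [integral_mul_const]

/-- The observational part of the candidate influence function, up to its normalisation. -/
def obsResidual (ψ : ℝ → Fin k → ℝ) (P : Measure (Record 𝒳)) (w : Record 𝒳) : ℝ :=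
  muBar ψ P w.2.1 - tauBar ψ P + iota P w * kappa ψ P w.2.1

/-- The experimental part of the candidate influence function, up to its normalisation. -/
def rctResidual (ψ : ℝ → Fin k → ℝ) (P : Measure (Record 𝒳)) (w : Record 𝒳) : ℝ :=
  (w.2.2 - muBar ψ P w.2.1) * (alphaBar ψ P ⬝ᵥ feat ψ P w.2.1)

theorem setLIntegral_eq_mul_cond {P : Measure (Record 𝒳)} [IsProbabilityMeasure P]
    {s : Set (Record 𝒳)} (hs : MeasurableSet s) (h0 : P s ≠ 0) {f g : Record 𝒳 → ℝ}
    (hfg : ∀ w ∈ s, f w = 1 / P.real s * g w) :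
    ∫⁻ w in s, ENNReal.ofReal (f w ^ 2) ∂P
      = (P s)⁻¹ * ∫⁻ w, ENNReal.ofReal (g w ^ 2) ∂(ProbabilityTheory.cond P s) := by
  have hpos : 0 < P.real s := ENNReal.toReal_pos h0 (measure_ne_top _ _)
  have e : ENNReal.ofReal ((1 / P.real s) ^ 2) = (P s)⁻¹ * (P s)⁻¹ := by
    rw [ENNReal.ofReal_pow (by positivity), one_div, ENNReal.ofReal_inv_of_pos hpos,
      ofReal_measureReal, pow_two]
  rw [ProbabilityTheory.cond, lintegral_smul_measure, smul_eq_mul, ← mul_assoc, ← e,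
    ← lintegral_const_mul' _ _ ENNReal.ofReal_ne_top]
  refine setLIntegral_congr_fun hs fun w hw => ?_
  rw [hfg w hw, mul_pow, ENNReal.ofReal_mul (by positivity)]

/-- The two parts of `φ` live on disjoint events. Squaring the factor `1 / P(s)` and integrating
over an event of mass `P(s)` leaves a single `P(s)⁻¹`. -/
theorem Veff_eq_add (ψ : ℝ → Fin k → ℝ) {P : Measure (Record 𝒳)} [IsProbabilityMeasure P]
    (h2 : P {w | w.1 = 2} ≠ 0) (hobs : P {w | w.1 ≠ 2} ≠ 0) :
    Veff ψ P = (P {w | w.1 = 2})⁻¹ * ∫⁻ w, ENNReal.ofReal (rctResidual ψ P w ^ 2) ∂(rctLaw P)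
      + (P {w | w.1 ≠ 2})⁻¹ * ∫⁻ w, ENNReal.ofReal (obsResidual ψ P w ^ 2) ∂(obsLaw P) := by
  rw [Veff, ← lintegral_add_compl _ (measurableSet_arm 2), rctLaw, obsLaw,
    ← setLIntegral_eq_mul_cond (f := eif ψ P) (measurableSet_arm 2) h2,
    ← setLIntegral_eq_mul_cond (f := eif ψ P) measurableSet_obs hobs]
  · rfl
  · intro w (hw : w.1 ≠ 2)
    rw [real_obs]
    simp [eif, hw, obsResidual]
  · intro w (hw : w.1 = 2)
    simp [eif, hw, rctResidual, rho, mul_assoc]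

section

variable {P R : Measure (Record 𝒳)}

theorem lawXY_congr [IsFiniteMeasure P] [IsFiniteMeasure R] (h2 : rctLaw R = rctLaw P)
    (ho : obsLaw R = obsLaw P) (q : Fin 3) : lawXY R q = lawXY P q := by
  by_cases hq : q = 2
  · subst hq
    exact congrArg (fun μ => Measure.map (fun w : Record 𝒳 => w.2) μ) h2
  -- Conditioning on an observational arm factors through conditioning on `Q ≠ 2`.
  · have hset : {w : Record 𝒳 | w.1 ≠ 2} ∩ {w | w.1 = q} = {w | w.1 = q} :=
      Set.inter_eq_right.2 fun w (hw : w.1 = q) => show w.1 ≠ 2 from hw ▸ hq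
    have e : ∀ (S : Measure (Record 𝒳)) [IsFiniteMeasure S],
        ProbabilityTheory.cond S {w | w.1 = q}
          = ProbabilityTheory.cond (obsLaw S) {w | w.1 = q} := fun S _ => by
      rw [obsLaw, cond_cond_eq_cond_inter measurableSet_obs (measurableSet_arm q), hset]
    rw [lawXY, lawXY, e R, e P, ho]

/-- Apart from the arm probabilities, the residuals depend on the law only through its two
conditional laws. -/
theorem residual_congr (ψ : ℝ → Fin k → ℝ) [IsFiniteMeasure P] [IsFiniteMeasure R]
    (h2 : rctLaw R = rctLaw P) (ho : obsLaw R = obsLaw P) :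
    obsResidual ψ R = obsResidual ψ P ∧ rctResidual ψ R = rctResidual ψ P := by
  have hm : ∀ q, condMean R q = condMean P q := fun q => by
    ext x
    rw [condMean, condMean]
    congr 2
    -- `condKernel` depends on the finiteness instance, so the measure is replaced together with it,
    -- as an element of a subtype.
    exact congrArg (fun μ : {μ : Measure (𝒳 × ℝ) // IsFiniteMeasure μ} =>
      @Measure.condKernel _ _ _ _ _ _ μ.1 μ.2)
      (Subtype.ext (lawXY_congr h2 ho q) : (⟨lawXY R q, inferInstance⟩ :
        {μ : Measure (𝒳 × ℝ) // IsFiniteMeasure μ}) = ⟨lawXY P q, inferInstance⟩)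
  have hc : contrast R = contrast P := by
    ext x
    rw [contrast, contrast, hm, hm]
  have hf : feat ψ R = feat ψ P := by
    ext x
    rw [feat, feat, hc]
  have hg : gram ψ R = gram ψ P := by rw [gram, gram, hf, h2]
  have hcr : crossMoment ψ R = crossMoment ψ P := by
    ext j
    rw [crossMoment, crossMoment, hf, h2]
  have hob : obsMoment ψ R = obsMoment ψ P := by
    ext j
    rw [obsMoment, obsMoment, hf, ho]
  have hβ : betaBar ψ R = betaBar ψ P := by rw [betaBar, betaBar, hg, hcr]
  have hα : alphaBar ψ R = alphaBar ψ P := by rw [alphaBar, alphaBar, hg, hob]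
  have hμ : muBar ψ R = muBar ψ P := by
    ext x
    rw [muBar, muBar, hf, hβ]
  have hτ : tauBar ψ R = tauBar ψ P := by rw [tauBar, tauBar, hob, hβ]
  have hX : obsX R = obsX P := by rw [obsX, obsX, ho]
  have hp : propensity R = propensity P := by
    ext x
    rw [propensity, propensity, ho, hX]
  have hl : likRatio R = likRatio P := by
    ext x
    rw [likRatio, likRatio, rctX, rctX, h2, hX]
  have hκ : kappa ψ R = kappa ψ P := by
    ext x
    rw [kappa, kappa, hc, hβ, hl, hα, hm, hf]
  have hι : iota R = iota P := by
    ext w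
    rw [iota, iota, hp, hm, hm]
  constructor
  · ext w
    rw [obsResidual, obsResidual, hμ, hτ, hι, hκ]
  · ext w
    rw [rctResidual, rctResidual, hμ, hα, hf]

end

theorem measure_ne_zero_of_isProbabilityMeasure_cond {P : Measure (Record 𝒳)}
    {s : Set (Record 𝒳)} (h : IsProbabilityMeasure (ProbabilityTheory.cond P s)) : P s ≠ 0 := by
  intro h0
  have := h.measure_univ
  rw [ProbabilityTheory.cond, Measure.restrict_eq_zero.2 h0] at this
  simp at this

namespace Identified

variable {ψ : ℝ → Fin k → ℝ} {P : Measure (Record 𝒳)} [IsProbabilityMeasure P]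

theorem integrable_rctResidual_sq (h : Identified ψ P) (hV : Veff ψ P < ∞) :
    Integrable (fun w => rctResidual ψ P w ^ 2) (rctLaw P) := by
  have hf := (measurable_feat h.contDiff P).comp (measurable_covariate (𝒳 := 𝒳))
  have hm : Measurable (rctResidual ψ P) :=
    (measurable_snd.snd.sub (measurable_dotProduct hf measurable_const)).mul
      (measurable_dotProduct measurable_const hf)
  refine ⟨(hm.pow_const 2).aestronglyMeasurable, ?_⟩
  rw [hasFiniteIntegral_iff_ofReal (Eventually.of_forall fun w => sq_nonneg _)]
  rw [Veff_eq_add ψ (h.arm_ne_zero 2) h.obs_ne_zero] at hV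
  exact ENNReal.lt_top_of_mul_ne_top_right (ENNReal.add_lt_top.1 hV).1.ne
    (ENNReal.inv_ne_zero.2 (measure_ne_top _ _))

theorem tendsto_mul_Veff (h : Identified ψ P) (hV : Veff ψ P < ∞) (R : ℕ → Measure (Record 𝒳))
    (hR : ∀ n, IsProbabilityMeasure (R n)) (h2 : ∀ n, rctLaw (R n) = rctLaw P)
    (ho : ∀ n, obsLaw (R n) = obsLaw P)
    (h0 : Tendsto (fun n => R n {w | w.1 = 2}) atTop (𝓝 0)) :
    Tendsto (fun n => R n {w | w.1 = 2} * Veff ψ (R n)) atTop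
      (𝓝 (ENNReal.ofReal (Sig ψ P))) := by
  have hS : ENNReal.ofReal (Sig ψ P)
      = ∫⁻ w, ENNReal.ofReal (rctResidual ψ P w ^ 2) ∂(rctLaw P) := by
    rw [← ofReal_integral_eq_lintegral_ofReal (h.integrable_rctResidual_sq hV)
      (Eventually.of_forall fun w => sq_nonneg _), Sig]
    simp only [alphaBar_dotProduct_meatIntegrand]
    rfl
  set A := ∫⁻ w, ENNReal.ofReal (obsResidual ψ P w ^ 2) ∂(obsLaw P) with hA
  have hA' : A ≠ ∞ := by
    rw [Veff_eq_add ψ (h.arm_ne_zero 2) h.obs_ne_zero] at hV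
    exact (ENNReal.lt_top_of_mul_ne_top_right (ENNReal.add_lt_top.1 hV).2.ne
      (ENNReal.inv_ne_zero.2 (measure_ne_top _ _))).ne
  have hrct := h.isProbabilityMeasure_rctLaw
  have hobs := h.isProbabilityMeasure_obsLaw
  -- With the residuals fixed, `ρ₂ V_eff` is exactly `Σ + ρ₂ (1 - ρ₂)⁻¹ A`, and `A` is finite
  -- because `V_eff` is finite at `P`.
  have e : ∀ n, R n {w | w.1 = 2} * Veff ψ (R n) = ENNReal.ofReal (Sig ψ P)
      + R n {w | w.1 = 2} * ((1 - R n {w | w.1 = 2})⁻¹ * A) := fun n => by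
    have := hR n
    -- Conditioning on a null event gives the zero measure, so equality with a conditional
    -- probability law of `P` forces positive mass.
    have n2 : R n {w | w.1 = 2} ≠ 0 :=
      measure_ne_zero_of_isProbabilityMeasure_cond (by rw [← h2 n] at hrct; exact hrct)
    have no : R n {w | w.1 ≠ 2} ≠ 0 :=
      measure_ne_zero_of_isProbabilityMeasure_cond (by rw [← ho n] at hobs; exact hobs)
    obtain ⟨r1, r2⟩ := residual_congr ψ (h2 n) (ho n)
    rw [Veff_eq_add ψ n2 no, r1, r2, h2, ho, ← hS, mul_add, ← mul_assoc,
      ENNReal.mul_inv_cancel n2 (measure_ne_top _ _), one_mul,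
      ← prob_compl_eq_one_sub (measurableSet_arm 2)]
    rfl
  simp only [e]
  have t1 : Tendsto (fun n => (1 - R n {w | w.1 = 2})⁻¹) atTop (𝓝 1) := by
    have := (ENNReal.Tendsto.sub (tendsto_const_nhds (x := (1 : ℝ≥0∞))) h0
      (Or.inl ENNReal.one_ne_top)).inv
    simpa using this
  have t2 : Tendsto (fun n => (1 - R n {w | w.1 = 2})⁻¹ * A) atTop (𝓝 A) := by
    simpa using ENNReal.Tendsto.mul_const t1 (Or.inl one_ne_zero)
  have t3 := ENNReal.Tendsto.mul h0 (Or.inr hA') t2 (Or.inr ENNReal.zero_ne_top)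
  rw [zero_mul] at t3
  simpa using tendsto_const_nhds.add t3

end Identified

end FusedData

end

theorem theorem2 {𝒳 : Type*} [MeasurableSpace 𝒳] {k : ℕ}
    (ψ : ℝ → Fin k → ℝ) (hψ : ContDiff ℝ 1 ψ)
    (P : Measure (FusedData.Record 𝒳)) [IsProbabilityMeasure P]
    -- the support of `Q` is `{0, 1, 2}`
    (hQ : ∀ q : Fin 3, P {w | w.1 = q} ≠ 0)
    -- the law of `X` in the observational data dominates the one in the experiment
    (hdom : FusedData.rctX P ≪ FusedData.obsX P)
    -- both treatments occur at almost every covariate value, so that `Δ` is defined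
    (hoverlap : ∀ᵐ x ∂(FusedData.obsX P),
      0 < FusedData.propensity P x ∧ FusedData.propensity P x < 1)
    -- the expectations that define `m_q` and the estimand exist
    (hY : Integrable (fun w : FusedData.Record 𝒳 => w.2.2) P)
    (hobs : ∀ j, Integrable (fun w => FusedData.feat ψ P w.2.1 j) (FusedData.obsLaw P))
    (hgram : ∀ i j, Integrable
      (fun w => FusedData.feat ψ P w.2.1 i * FusedData.feat ψ P w.2.1 j) (FusedData.rctLaw P))
    (hcross : ∀ j, Integrable
      (fun w => w.2.2 * FusedData.feat ψ P w.2.1 j) (FusedData.rctLaw P))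
    -- linear independence of the components of `ψ(Δ(X))` given `Q = 2`
    (hlin : ∀ c : Fin k → ℝ, c ≠ 0 →
      FusedData.rctLaw P {w | c ⬝ᵥ FusedData.feat ψ P w.2.1 = 0} < 1) :
    -- the estimand is differentiable along every smooth submodel, with the stated gradient
    (∀ M : FusedData.SmoothSubmodel ψ P,
      DifferentiableAt ℝ M.tau 0 ∧
      (Integrable (fun w => FusedData.eif ψ P w * M.score w) P →
        HasDerivAt M.tau (∫ w, FusedData.eif ψ P w * M.score w ∂P) 0)) ∧
    -- the tangent space consists of all mean zero square integrable functions
    (∀ g : Lp ℝ 2 P, g ∈ FusedData.tangentSpace ψ P ↔ ∫ w, g w ∂P = 0) ∧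
    -- the efficient influence function
    (FusedData.Veff ψ P < ∞ →
      FusedData.IsEfficientInfluenceFunction ψ P (FusedData.eif ψ P) ∧
      ∀ φ, FusedData.IsEfficientInfluenceFunction ψ P φ → φ =ᵐ[P] FusedData.eif ψ P) ∧
    -- the efficiency bound
    FusedData.efficiencyBound ψ P = FusedData.Veff ψ P ∧
    -- the regime in which the experiment becomes relatively small
    (FusedData.Veff ψ P < ∞ →
      Integrable (fun w => FusedData.alphaBar ψ P ⬝ᵥ
        (FusedData.meatIntegrand ψ P w *ᵥ FusedData.alphaBar ψ P)) (FusedData.rctLaw P) ∧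
      ((∀ i j, Integrable (fun w => FusedData.meatIntegrand ψ P w i j) (FusedData.rctLaw P)) →
        FusedData.Sig ψ P =
          FusedData.alphaBar ψ P ⬝ᵥ (FusedData.meat ψ P *ᵥ FusedData.alphaBar ψ P)) ∧
      ∀ R : ℕ → Measure (FusedData.Record 𝒳),
        (∀ n, IsProbabilityMeasure (R n)) →
        (∀ n, FusedData.rctLaw (R n) = FusedData.rctLaw P) →
        (∀ n, FusedData.obsLaw (R n) = FusedData.obsLaw P) →
        Tendsto (fun n => R n {w | w.1 = 2}) atTop (𝓝 0) →
        Tendsto (fun n => R n {w | w.1 = 2} * FusedData.Veff ψ (R n)) atTop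
          (𝓝 (ENNReal.ofReal (FusedData.Sig ψ P)))) := by
  have h : FusedData.Identified ψ P :=
    { arm_ne_zero := hQ
      dominated := hdom
      propensity_mem := hoverlap
      contDiff := hψ
      integrable_outcome := hY
      integrable_feat := hobs
      integrable_gram := hgram
      integrable_cross := hcross
      linearIndependent := hlin }
  refine ⟨fun M => ⟨(M.hasDerivAt_tau h).2.differentiableAt, h.hasDerivAt_tau_of_integrable M⟩,
    h.mem_tangentSpace_iff, fun hV => ⟨h.isEfficientInfluenceFunction_eif hV, fun φ hφ =>
      hφ.ae_eq (h.isEfficientInfluenceFunction_eif hV)⟩, h.efficiencyBound_eq, fun hV =>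
    ⟨?_, FusedData.Sig_eq_of_integrable, h.tendsto_mul_Veff hV⟩⟩
  simp only [FusedData.alphaBar_dotProduct_meatIntegrand]
  exact h.integrable_rctResidual_sq hV
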